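/- Let $G$ be a discrete group. A $G$-$C^*$-algebra is a (complex, not necessarily unital) $C^*$-algebra with an action of $G$ by $*$-automorphisms. For a $G$-$C^*$-algebra $(A,\alpha)$ let $A\rtimes_{\mathrm{alg}}G$ be the $*$-algebra of finitely supported functions $f\colon G\to A$ with $(f*g)(t)=\sum_{s\in G} f(s)\,\alpha_s(g(s^{-1}t))$ and $f^*(s)=\alpha_s(f(s^{-1})^*)$, and let $\Lambda\colon -\rtimes_{\max}G\to -\rtimes_r G$ be the canonical natural transformation from the maximal to the reduced crossed product functor that extends the identity of $A\rtimes_{\mathrm{alg}}G$. A crossed product functor is a functor $-\rtimes_\mu G$ from $G$-$C^*$-algebras with $G$-equivariant $*$-homomorphisms to $C^*$-algebras with $*$-homomorphisms, together with natural transformations $q\colon -\rtimes_{\max}G\to -\rtimes_\mu G$ and $s\colon -\rtimes_\mu G\to -\rtimes_r G$ consisting of surjective $*$-homomorphisms such that $s\circ q=\Lambda$. It is a correspondence crossed product functor if it has the cp-map property: for every $G$-equivariant completely positive map $\varphi\colon A\to B$ between $G$-$C^*$-algebras there is a completely positive map $\varphi\rtimes_\mu G\colon A\rtimes_\mu G\to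 B\rtimes_\mu G$ that sends (the image of) $f$ to (the image of) $\varphi\circ f$ for all $f\in A\rtimes_{\mathrm{alg}}G$. It is exact if for every short exact sequence $0\to I\to A\to Q\to 0$ of $G$-$C^*$-algebras (equivalently, for every $G$-invariant closed ideal $I$ of a $G$-$C^*$-algebra $A$ and $Q=A/I$) the sequence $0\to I\rtimes_\mu G\to A\rtimes_\mu G\to Q\rtimes_\mu G\to 0$ is exact, and exact for trivial actions if this holds whenever $G$ acts trivially on $I$, $A$ and $Q$. For a $C^*$-algebra $A$ put $A\otimes_\mu C^*_\mu G := A\rtimes_{\mu,\mathrm{id}}G$, the crossed product for the trivial action. Let $-\rtimes_\mu G$ be a correspondence crossed product functor for the discrete group $G$. Then $-\rtimes_\mu G$ is exact if and only if it is exact for trivial actions. Equivalently, $-\rtimes_\mu G$ is exact if and only if the functor $A\mapsto A\otimes_\mu C^*_\mu G$ is exact on the category of $C^*$-algebras, i.e. maps short exact sequences of $C^*$-algebras to short exact sequences. -/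

import Mathlib

universe u

open CategoryTheory

/-! ### Categories of C*-algebras and of `G`-C*-algebras -/

/-- A (complex, possibly non-unital) C*-algebra, bundled. -/
structure CStarAlg where
  carrier : Type u
  [inst : NonUnitalCStarAlgebra carrier]

namespace CStarAlg

instance : CoeSort CStarAlg.{u} (Type u) := ⟨carrier⟩

attribute [instance] CStarAlg.inst

/-- The canonical order of a C*-algebra: `a ≤ b` iff `b - a` is positive. -/
noncomputable instance instPartialOrder (A : CStarAlg.{u}) : PartialOrder A :=
  CStarAlgebra.spectralOrder A

instance instStarOrderedRing (A : CStarAlg.{u}) : StarOrderedRing A :=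
  CStarAlgebra.spectralOrderedRing A

/-- Morphisms of C*-algebras: the *-homomorphisms. -/
@[ext]
structure Hom (A B : CStarAlg.{u}) where
  hom : A →⋆ₙₐ[ℂ] B

instance : Category CStarAlg.{u} where
  Hom A B := Hom A B
  id A := ⟨NonUnitalStarAlgHom.id ℂ A⟩
  comp f g := ⟨g.hom.comp f.hom⟩

@[ext]
theorem hom_ext {A B : CStarAlg.{u}} {f g : A ⟶ B} (h : ∀ x, f.hom x = g.hom x) : f = g :=
  Hom.ext (NonUnitalStarAlgHom.ext h)

@[simp] theorem id_hom_apply (A : CStarAlg.{u}) (x : A) : Hom.hom (𝟙 A) x = x := rfl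

@[simp] theorem comp_hom_apply {A B C : CStarAlg.{u}} (f : A ⟶ B) (g : B ⟶ C) (x : A) :
    (f ≫ g).hom x = g.hom (f.hom x) := rfl

/-- `0 → I → A → Q → 0` is a short exact sequence of C*-algebras. -/
structure IsShortExact {I A Q : CStarAlg.{u}} (i : I ⟶ A) (p : A ⟶ Q) : Prop where
  injective : Function.Injective i.hom
  exact : ∀ a : A, p.hom a = 0 ↔ ∃ x : I, i.hom x = a
  surjective : Function.Surjective p.hom

end CStarAlg

/-- A `G`-C*-algebra for a discrete group `G`: a C*-algebra with an action of `G` by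
*-automorphisms. -/
structure GCStarAlg (G : Type u) [Group G] extends CStarAlg.{u} where
  action : G →* (carrier ≃⋆ₐ[ℂ] carrier)

namespace GCStarAlg

variable {G : Type u} [Group G]

instance : CoeSort (GCStarAlg G) (Type u) := ⟨fun A => A.toCStarAlg.carrier⟩

/-- Morphisms of `G`-C*-algebras: the `G`-equivariant *-homomorphisms. -/
@[ext]
structure Hom (A B : GCStarAlg G) where
  hom : A →⋆ₙₐ[ℂ] B
  equivariant : ∀ (g : G) (a : A), hom (A.action g a) = B.action g (hom a)

instance : Category (GCStarAlg G) where
  Hom A B := Hom A B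
  id A := ⟨NonUnitalStarAlgHom.id ℂ A, fun _ _ => rfl⟩
  comp f g := ⟨g.hom.comp f.hom, fun s a => by
    simp [f.equivariant, g.equivariant]⟩

@[simp] theorem id_hom_apply (A : GCStarAlg G) (x : A) : Hom.hom (𝟙 A) x = x := rfl

@[simp] theorem comp_hom_apply {A B C : GCStarAlg G} (f : A ⟶ B) (g : B ⟶ C) (x : A) :
    (f ≫ g).hom x = g.hom (f.hom x) := rfl

/-- The functor forgetting the action. -/
def forgetAction (G : Type u) [Group G] : GCStarAlg G ⥤ CStarAlg.{u} where
  obj A := A.toCStarAlg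
  map f := ⟨f.hom⟩

/-- The functor endowing a C*-algebra with the trivial `G`-action. -/
def trivialAction (G : Type u) [Group G] : CStarAlg.{u} ⥤ GCStarAlg G where
  obj A := { toCStarAlg := A, action := 1 }
  map f := ⟨f.hom, fun _ _ => rfl⟩

/-- The action of `G` on `A` is trivial. -/
def IsTrivial (A : GCStarAlg G) : Prop := ∀ (g : G) (a : A), A.action g a = a

/-- `0 → I → A → Q → 0` is a short exact sequence of `G`-C*-algebras. Up to isomorphism these are
the sequences `0 → I → A → A/I → 0` given by the `G`-invariant ideals `I` of `A`. -/
def IsShortExact {I A Q : GCStarAlg G} (i : I ⟶ A) (p : A ⟶ Q) : Prop :=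
  CStarAlg.IsShortExact ((forgetAction G).map i) ((forgetAction G).map p)

theorem action_mul_apply (A : GCStarAlg G) (s t : G) (a : A) :
    A.action (s * t) a = A.action s (A.action t a) := by rw [map_mul]; rfl

theorem action_one_apply (A : GCStarAlg G) (a : A) : A.action 1 a = a := by
  rw [map_one]; rfl

theorem norm_action (A : GCStarAlg G) (s : G) (a : A) : ‖A.action s a‖ = ‖a‖ :=
  NonUnitalStarAlgHom.norm_map (A.action s) (A.action s).injective a

end GCStarAlg

/-! ### The algebraic crossed product -/

/-- The algebraic crossed product of `A` by the discrete group `G`: the finitely supported functions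
`G → A`, with twisted convolution as product. -/
def AlgCrossedProduct {G : Type u} [Group G] (A : GCStarAlg G) : Type u := G →₀ A

namespace AlgCrossedProduct

variable {G : Type u} [Group G]

noncomputable section

section Basic

variable (A : GCStarAlg G)

instance : AddCommGroup (AlgCrossedProduct A) := inferInstanceAs (AddCommGroup (G →₀ A))
instance : Module ℂ (AlgCrossedProduct A) := inferInstanceAs (Module ℂ (G →₀ A))
instance : FunLike (AlgCrossedProduct A) G A := inferInstanceAs (FunLike (G →₀ A) G A)

end Basic

variable {A B C : GCStarAlg G}

/-- The function with value `a` at `s` and `0` elsewhere. -/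
def single (s : G) : A →ₗ[ℂ] AlgCrossedProduct A := Finsupp.lsingle s

/-- Linear extension from the functions supported at one point. -/
def liftLin {M : Type*} [AddCommGroup M] [Module ℂ M] (φ : G → A →ₗ[ℂ] M) :
    AlgCrossedProduct A →ₗ[ℂ] M := Finsupp.lsum ℂ φ

@[simp] theorem liftLin_single {M : Type*} [AddCommGroup M] [Module ℂ M] (φ : G → A →ₗ[ℂ] M)
    (s : G) (a : A) : liftLin φ (single s a) = φ s a :=
  Finsupp.lsum_single ℂ φ s a

@[ext]
theorem ext {f g : AlgCrossedProduct A} (h : ∀ s, f s = g s) : f = g := Finsupp.ext h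

@[simp] theorem add_apply (f g : AlgCrossedProduct A) (s : G) : (f + g) s = f s + g s := rfl
@[simp] theorem zero_apply (s : G) : (0 : AlgCrossedProduct A) s = 0 := rfl

open Classical in
theorem single_apply (s t : G) (a : A) : single s a t = if s = t then a else 0 :=
  Finsupp.single_apply

@[elab_as_elim]
theorem induction {p : AlgCrossedProduct A → Prop} (f : AlgCrossedProduct A)
    (zero : p 0) (single : ∀ s a, p (single s a)) (add : ∀ f g, p f → p g → p (f + g)) : p f :=
  Finsupp.induction_linear f zero add single

/-- `(a δ_s) (b δ_t) = a α_s(b) δ_{st}`, extended bilinearly. -/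
def mulLin (A : GCStarAlg G) :
    AlgCrossedProduct A →ₗ[ℂ] AlgCrossedProduct A →ₗ[ℂ] AlgCrossedProduct A :=
  liftLin fun s => LinearMap.flip <| liftLin fun t => LinearMap.flip <|
    (LinearMap.mul ℂ A).compr₂ (single (s * t)) |>.compl₂ (A.action s : A →ₗ[ℂ] A)

instance : Mul (AlgCrossedProduct A) := ⟨fun f g => mulLin A f g⟩

theorem mul_def (f g : AlgCrossedProduct A) : f * g = mulLin A f g := rfl

@[simp] theorem single_mul_single (s t : G) (a b : A) :
    single s a * single t b = single (s * t) (a * A.action s b) := by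
  simp [mul_def, mulLin]

/-- The product of the algebraic crossed product is the twisted convolution. -/
theorem mul_apply (f g : AlgCrossedProduct A) (t : G) :
    (f * g) t = ∑ᶠ s, f s * A.action s (g (s⁻¹ * t)) := by
  classical
  induction f using induction with
  | zero => simp [mul_def]
  | add f₁ f₂ h₁ h₂ =>
    have hfin : ∀ f : AlgCrossedProduct A,
        (Function.support fun s => f s * A.action s (g (s⁻¹ * t))).Finite := fun f =>
      (Finsupp.hasFiniteSupport (f : G →₀ A)).subset fun s hs h0 => hs (by
        have : f s = 0 := h0
        simp [this])
    rw [mul_def] at h₁ h₂ ⊢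
    rw [map_add, LinearMap.add_apply, add_apply, h₁, h₂, ← finsum_add_distrib (hfin _) (hfin _)]
    simp [add_mul]
  | single s a =>
    rw [finsum_eq_single _ s (fun r hr => by simp [single_apply, hr.symm])]
    induction g using induction with
    | zero => simp [mul_def]
    | add g₁ g₂ h₁ h₂ =>
      rw [mul_def] at h₁ h₂ ⊢
      rw [map_add, add_apply, h₁, h₂, add_apply, map_add, mul_add]
    | single r b =>
      rw [single_mul_single, single_apply, single_apply, single_apply, if_pos rfl]
      by_cases h : s * r = t
      · subst h; simp
      · have : r ≠ s⁻¹ * t := fun h' => h (by simp [h'])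
        simp [h, this]

/-- `(a δ_s)^* = α_{s⁻¹}(a^*) δ_{s⁻¹}`, extended conjugate-linearly. -/
def starFun (f : AlgCrossedProduct A) : AlgCrossedProduct A :=
  Finsupp.equivMapDomain (Equiv.inv G)
    (Finsupp.onFinset (Finsupp.support (f : G →₀ A)) (fun s => A.action s⁻¹ (star (f s)))
      fun s hs => Finsupp.mem_support_iff.2 fun h => hs (by
        have h' : f s = 0 := h
        simp [h']))

instance : Star (AlgCrossedProduct A) := ⟨starFun⟩

theorem star_apply (f : AlgCrossedProduct A) (s : G) : star f s = A.action s (star (f s⁻¹)) := by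
  change A.action (s⁻¹)⁻¹ _ = _
  rw [inv_inv]; rfl

@[simp] theorem star_single (s : G) (a : A) :
    star (single s a) = single s⁻¹ (A.action s⁻¹ (star a)) := by
  classical
  ext t
  rw [star_apply, single_apply, single_apply]
  by_cases h : s⁻¹ = t
  · subst h; simp
  · have : s ≠ t⁻¹ := fun h' => h (by simp [h'])
    simp [h, this]

instance : NonUnitalRing (AlgCrossedProduct A) where
  left_distrib f g h := by simp [mul_def]
  right_distrib f g h := by simp [mul_def]
  zero_mul f := by simp [mul_def]
  mul_zero f := by simp [mul_def]
  mul_assoc f g h := by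
    have hadd : ∀ f g h : AlgCrossedProduct A, (f + g) * h = f * h + g * h :=
      fun f g h => by simp [mul_def]
    have hadd' : ∀ f g h : AlgCrossedProduct A, f * (g + h) = f * g + f * h :=
      fun f g h => by simp [mul_def]
    have h0 : ∀ f : AlgCrossedProduct A, 0 * f = 0 := fun f => by simp [mul_def]
    have h0' : ∀ f : AlgCrossedProduct A, f * 0 = 0 := fun f => by simp [mul_def]
    induction f using induction with
    | zero => simp only [h0]
    | add f₁ f₂ h₁ h₂ => simp only [hadd, h₁, h₂]
    | single s a =>
      induction g using induction with
      | zero => simp only [h0, h0']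
      | add f₁ f₂ h₁ h₂ => simp only [hadd, hadd', h₁, h₂]
      | single t b =>
        induction h using induction with
        | zero => simp only [h0']
        | add f₁ f₂ h₁ h₂ => simp only [hadd', h₁, h₂]
        | single r c => simp [mul_assoc]

instance : IsScalarTower ℂ (AlgCrossedProduct A) (AlgCrossedProduct A) :=
  ⟨fun c f g => by simp [mul_def]⟩

instance : SMulCommClass ℂ (AlgCrossedProduct A) (AlgCrossedProduct A) :=
  ⟨fun c f g => by simp [mul_def]⟩

instance : StarRing (AlgCrossedProduct A) where
  star_involutive f := by
    ext s
    rw [star_apply, star_apply, map_star, ← GCStarAlg.action_mul_apply]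
    simp
  star_add f g := by
    ext s
    simp [star_apply]
  star_mul f g := by
    have hadd : ∀ f g : AlgCrossedProduct A, star (f + g) = star f + star g :=
      fun f g => by ext s; simp [star_apply]
    have h0 : star (0 : AlgCrossedProduct A) = 0 := by ext s; simp [star_apply]
    induction f using induction with
    | zero => simp [h0]
    | add f₁ f₂ h₁ h₂ => rw [add_mul, hadd, h₁, h₂, hadd, mul_add]
    | single s a =>
      induction g using induction with
      | zero => simp [h0]
      | add f₁ f₂ h₁ h₂ => rw [mul_add, hadd, h₁, h₂, hadd, add_mul]
      | single t b =>
        simp only [single_mul_single, star_single, mul_inv_rev, star_mul]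
        rw [map_mul, GCStarAlg.action_mul_apply A t⁻¹ s⁻¹, ← map_star (A.action s),
          ← GCStarAlg.action_mul_apply A s⁻¹ s, inv_mul_cancel, GCStarAlg.action_one_apply,
          GCStarAlg.action_mul_apply]

instance : StarModule ℂ (AlgCrossedProduct A) where
  star_smul c f := by
    ext s
    rw [star_apply]
    change A.action s (star (c • f s⁻¹)) = star c • (star f s)
    rw [star_apply, star_smul, map_smul]

/-- The *-homomorphism of the algebraic crossed product determined by its values on the functions
supported at one point. -/
def lift {R : Type*} [NonUnitalRing R] [StarRing R] [Module ℂ R] (φ : G → A →ₗ[ℂ] R)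
    (hmul : ∀ s t a b, φ (s * t) (a * A.action s b) = φ s a * φ t b)
    (hstar : ∀ s a, φ s⁻¹ (A.action s⁻¹ (star a)) = star (φ s a)) :
    AlgCrossedProduct A →⋆ₙₐ[ℂ] R where
  toFun := liftLin φ
  map_smul' c f := by simp
  map_zero' := map_zero _
  map_add' := map_add _
  map_mul' f g := by
    induction f using induction with
    | zero => simp
    | add f₁ f₂ h₁ h₂ => rw [add_mul, map_add, h₁, h₂, map_add, add_mul]
    | single s a =>
      induction g using induction with
      | zero => simp
      | add f₁ f₂ h₁ h₂ => rw [mul_add, map_add, h₁, h₂, map_add, mul_add]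
      | single t b => simp [hmul]
  map_star' f := by
    induction f using induction with
    | zero => simp
    | add f₁ f₂ h₁ h₂ => rw [star_add, map_add, h₁, h₂, map_add, star_add]
    | single s a => rw [star_single, liftLin_single, liftLin_single, hstar]

@[simp] theorem lift_single {R : Type*} [NonUnitalRing R] [StarRing R] [Module ℂ R]
    (φ : G → A →ₗ[ℂ] R) (hmul : ∀ s t a b, φ (s * t) (a * A.action s b) = φ s a * φ t b)
    (hstar : ∀ s a, φ s⁻¹ (A.action s⁻¹ (star a)) = star (φ s a)) (s : G) (a : A) :
    lift φ hmul hstar (single s a) = φ s a := liftLin_single φ s a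

/-- The linear map `f ↦ φ ∘ f` given by a linear map `φ : A → B`. -/
def mapLin (φ : A →ₗ[ℂ] B) : AlgCrossedProduct A →ₗ[ℂ] AlgCrossedProduct B :=
  Finsupp.mapRange.linearMap φ

@[simp] theorem mapLin_apply (φ : A →ₗ[ℂ] B) (f : AlgCrossedProduct A) (s : G) :
    mapLin φ f s = φ (f s) := rfl

/-- The *-homomorphism `f ↦ φ ∘ f` given by an equivariant *-homomorphism `φ : A → B`. -/
def map (φ : A ⟶ B) : AlgCrossedProduct A →⋆ₙₐ[ℂ] AlgCrossedProduct B :=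
  lift (fun s => single s ∘ₗ (φ.hom : A →ₗ[ℂ] B))
    (fun s t a b => by simp [φ.equivariant])
    (fun s a => by
      change single s⁻¹ (φ.hom (A.action s⁻¹ (star a))) = star (single s (φ.hom a))
      rw [φ.equivariant, map_star, star_single])

@[simp] theorem map_single (φ : A ⟶ B) (s : G) (a : A) :
    map φ (single s a) = single s (φ.hom a) := by simp [map]

@[simp] theorem map_apply (φ : A ⟶ B) (f : AlgCrossedProduct A) (s : G) :
    map φ f s = φ.hom (f s) := by
  classical
  induction f using induction with
  | zero => simp
  | add f₁ f₂ h₁ h₂ => simp [h₁, h₂]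
  | single t a => rw [map_single, single_apply, single_apply]; split_ifs <;> simp

/-- The norms of the images of an element under all *-homomorphisms into C*-algebras are bounded. -/
theorem exists_norm_le (f : AlgCrossedProduct A) :
    ∃ c : ℝ, ∀ (B : CStarAlg.{u}) (π : AlgCrossedProduct A →⋆ₙₐ[ℂ] B), ‖π f‖ ≤ c := by
  induction f using induction with
  | zero => exact ⟨0, fun B π => by simp⟩
  | add f₁ f₂ h₁ h₂ =>
    obtain ⟨c₁, h₁⟩ := h₁
    obtain ⟨c₂, h₂⟩ := h₂
    refine ⟨c₁ + c₂, fun B π => ?_⟩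
    rw [map_add]
    exact norm_add_le_of_le (h₁ B π) (h₂ B π)
  | single s a =>
    refine ⟨‖a‖, fun B π => ?_⟩
    let ρ : A →⋆ₙₐ[ℂ] B :=
      { toFun := fun a => π (single 1 a)
        map_smul' := fun c a => by simp
        map_zero' := by simp
        map_add' := fun a b => by simp
        map_mul' := fun a b => by
          rw [← map_mul, single_mul_single, GCStarAlg.action_one_apply, one_mul]
        map_star' := fun a => by
          rw [← map_star, star_single, inv_one, GCStarAlg.action_one_apply] }
    have h1 : star (π (single s a)) * π (single s a) = ρ (A.action s⁻¹ (star a * a)) := by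
      rw [← map_star, ← map_mul, star_single, single_mul_single, ← map_mul, inv_mul_cancel]
      rfl
    have h2 : ‖π (single s a)‖ * ‖π (single s a)‖ ≤ ‖a‖ * ‖a‖ := by
      rw [← CStarRing.norm_star_mul_self, h1, ← CStarRing.norm_star_mul_self (x := a)]
      exact (NonUnitalStarAlgHom.norm_apply_le ρ _).trans (GCStarAlg.norm_action A _ _).le
    exact abs_le_of_sq_le_sq' (by simpa [sq] using h2) (norm_nonneg _) |>.2

end

end AlgCrossedProduct

/-! ### Completion of a *-algebra with respect to a C*-seminorm -/

/-- A C*-seminorm on a complex *-algebra. -/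
structure CStarSeminorm (R : Type u) [NonUnitalRing R] [StarRing R] [Module ℂ R] extends
    Seminorm ℂ R where
  mul_le' : ∀ x y, toFun (x * y) ≤ toFun x * toFun y
  star_mul_self' : ∀ x, toFun (star x * x) = toFun x * toFun x

namespace CStarSeminorm

noncomputable section

set_option linter.unusedSectionVars false

/-- The supremum of the C*-seminorms `x ↦ ‖π x‖`, where `π` runs through a pointwise bounded family
of *-homomorphisms into C*-algebras. -/
def ofReps {R : Type u} [NonUnitalRing R] [StarRing R] [Module ℂ R] {ι : Type*} [Nonempty ι]
    (B : ι → CStarAlg.{u}) (π : ∀ i, R →⋆ₙₐ[ℂ] B i)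
    (hπ : ∀ x, BddAbove (Set.range fun i => ‖π i x‖)) : CStarSeminorm R where
  toFun x := ⨆ i, ‖π i x‖
  map_zero' := by simp
  add_le' x y := ciSup_le fun i => by
    rw [map_add]
    exact norm_add_le_of_le (le_ciSup (hπ x) i) (le_ciSup (hπ y) i)
  neg' x := by simp
  smul' c x := by
    simp only [map_smul, norm_smul]
    exact (Real.mul_iSup_of_nonneg (norm_nonneg c) _).symm
  mul_le' x y := ciSup_le fun i => by
    rw [map_mul]
    exact norm_mul_le_of_le (le_ciSup (hπ x) i) (le_ciSup (hπ y) i)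
  star_mul_self' x := by
    have h0 : ∀ i, 0 ≤ ‖π i x‖ := fun i => norm_nonneg _
    simp only [map_mul, map_star, CStarRing.norm_star_mul_self]
    apply le_antisymm
    · exact ciSup_le fun i => mul_self_le_mul_self (h0 i) (le_ciSup (hπ x) i)
    · have hb : BddAbove (Set.range fun i => ‖π i x‖ * ‖π i x‖) := by
        obtain ⟨c, hc⟩ := hπ x
        refine ⟨c * c, ?_⟩
        rintro _ ⟨i, rfl⟩
        exact mul_self_le_mul_self (h0 i) (hc ⟨i, rfl⟩)
      have h1 : ⨆ i, ‖π i x‖ ≤ √(⨆ i, ‖π i x‖ * ‖π i x‖) :=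
        ciSup_le fun i => Real.le_sqrt_of_sq_le (by
          rw [sq]; exact le_ciSup hb i)
      have h2 : 0 ≤ ⨆ i, ‖π i x‖ * ‖π i x‖ := Real.iSup_nonneg fun i => mul_self_nonneg _
      calc _ ≤ √(⨆ i, ‖π i x‖ * ‖π i x‖) * √(⨆ i, ‖π i x‖ * ‖π i x‖) :=
            mul_self_le_mul_self (Real.iSup_nonneg h0) h1
        _ = _ := Real.mul_self_sqrt h2

theorem ofReps_apply {R : Type u} [NonUnitalRing R] [StarRing R] [Module ℂ R] {ι : Type*}
    [Nonempty ι] (B : ι → CStarAlg.{u}) (π : ∀ i, R →⋆ₙₐ[ℂ] B i)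
    (hπ : ∀ x, BddAbove (Set.range fun i => ‖π i x‖)) (x : R) :
    (ofReps B π hπ).toSeminorm x = ⨆ i, ‖π i x‖ := rfl

variable {R : Type u} [NonUnitalRing R] [StarRing R] [Module ℂ R] [IsScalarTower ℂ R R]
  [SMulCommClass ℂ R R] [StarModule ℂ R]

/-- A copy of `R`, seminormed by `p`. -/
def Pre (_p : CStarSeminorm R) : Type u := R

variable (p : CStarSeminorm R)

instance : NonUnitalRing p.Pre := inferInstanceAs (NonUnitalRing R)
instance : StarRing p.Pre := inferInstanceAs (StarRing R)
instance : Module ℂ p.Pre := inferInstanceAs (Module ℂ R)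
instance : IsScalarTower ℂ p.Pre p.Pre := inferInstanceAs (IsScalarTower ℂ R R)
instance : SMulCommClass ℂ p.Pre p.Pre := inferInstanceAs (SMulCommClass ℂ R R)
instance : StarModule ℂ p.Pre := inferInstanceAs (StarModule ℂ R)

instance : NonUnitalSeminormedRing p.Pre where
  toNonUnitalRing := inferInstance
  toPseudoMetricSpace := p.toSeminorm.toAddGroupSeminorm.toSeminormedAddGroup.toPseudoMetricSpace
  norm := p.toSeminorm
  dist_eq := p.toSeminorm.toAddGroupSeminorm.toSeminormedAddGroup.dist_eq
  norm_mul_le := p.mul_le'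

theorem pre_norm (x : p.Pre) : ‖x‖ = p.toSeminorm x := rfl

instance : NormedSpace ℂ p.Pre where
  norm_smul_le c x := (map_smul_eq_mul p.toSeminorm c (x : R)).le

theorem pre_norm_star_mul_self (x : p.Pre) : ‖star x * x‖ = ‖x‖ * ‖x‖ := p.star_mul_self' x

theorem pre_norm_star (x : p.Pre) : ‖star x‖ = ‖x‖ := by
  have key : ∀ x : p.Pre, ‖x‖ ≤ ‖star x‖ := fun x => by
    by_contra! h
    have h1 : ‖x‖ * ‖x‖ ≤ ‖star x‖ * ‖x‖ := by
      rw [← pre_norm_star_mul_self]; exact norm_mul_le _ _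
    have h2 : 0 < ‖x‖ := (norm_nonneg _).trans_lt h
    exact absurd (le_of_mul_le_mul_right h1 h2) (not_le.2 h)
  exact le_antisymm (by simpa using key (star x)) (key x)

/-- The Hausdorff completion of `R` with respect to `p`. -/
def Completion : Type u := UniformSpace.Completion p.Pre

namespace Completion

instance : NormedAddCommGroup p.Completion :=
  inferInstanceAs (NormedAddCommGroup (UniformSpace.Completion p.Pre))
instance : NormedSpace ℂ p.Completion :=
  inferInstanceAs (NormedSpace ℂ (UniformSpace.Completion p.Pre))
instance : CompleteSpace p.Completion :=
  inferInstanceAs (CompleteSpace (UniformSpace.Completion p.Pre))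

/-- The canonical linear map from `R` to the completion. -/
def ofPre : p.Pre →L[ℂ] p.Completion := UniformSpace.Completion.toComplL

theorem norm_ofPre (x : p.Pre) : ‖ofPre p x‖ = ‖x‖ := UniformSpace.Completion.norm_coe x

theorem denseRange_ofPre : DenseRange (ofPre p) := UniformSpace.Completion.denseRange_coe

theorem isUniformInducing_ofPre : IsUniformInducing (ofPre p) :=
  UniformSpace.Completion.isUniformInducing_coe _

/-- The product of `p.Completion`, as a continuous bilinear map. -/
def mulCLM : p.Completion →L[ℂ] p.Completion →L[ℂ] p.Completion :=
  ContinuousLinearMap.extend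
    ((ContinuousLinearMap.extend
      (((ContinuousLinearMap.compL ℂ _ _ _ (ofPre p)).comp (ContinuousLinearMap.mul ℂ p.Pre)).flip)
      (ofPre p)).flip) (ofPre p)

theorem mulCLM_ofPre (x y : p.Pre) : mulCLM p (ofPre p x) (ofPre p y) = ofPre p (x * y) := by
  have h1 := (denseRange_ofPre p)
  have h2 := (isUniformInducing_ofPre p)
  rw [mulCLM, ContinuousLinearMap.extend_eq _ h1 h2, ContinuousLinearMap.flip_apply,
    ContinuousLinearMap.extend_eq _ h1 h2]
  rfl

/-- The involution of `p.Completion`. -/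
def starMap : p.Completion → p.Completion :=
  UniformSpace.Completion.map (star : p.Pre → p.Pre)

theorem pre_uniformContinuous_star : UniformContinuous (star : p.Pre → p.Pre) :=
  (Isometry.of_dist_eq fun x y => by
    rw [dist_eq_norm, dist_eq_norm, ← star_sub, pre_norm_star]).uniformContinuous

theorem starMap_ofPre (x : p.Pre) : starMap p (ofPre p x) = ofPre p (star x) :=
  UniformSpace.Completion.map_coe (pre_uniformContinuous_star p) x

theorem continuous_starMap : Continuous (starMap p) := UniformSpace.Completion.continuous_map

instance : Mul p.Completion := ⟨fun x y => mulCLM p x y⟩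

theorem mul_def (x y : p.Completion) : x * y = mulCLM p x y := rfl

instance : Star p.Completion := ⟨starMap p⟩

theorem ofPre_mul (x y : p.Pre) : ofPre p (x * y) = ofPre p x * ofPre p y :=
  (mulCLM_ofPre p x y).symm

theorem ofPre_star (x : p.Pre) : ofPre p (star x) = star (ofPre p x) := (starMap_ofPre p x).symm

instance : ContinuousMul p.Completion where
  continuous_mul := by
    simp only [mul_def]
    fun_prop

instance : ContinuousStar p.Completion where
  continuous_star := continuous_starMap p

instance : NonUnitalRing p.Completion where
  left_distrib x y z := by simp [mul_def]
  right_distrib x y z := by simp [mul_def]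
  zero_mul x := by simp [mul_def]
  mul_zero x := by simp [mul_def]
  mul_assoc x y z := by
    refine (denseRange_ofPre p).induction_on₃ (p := fun x y z => x * y * z = x * (y * z))
      (isClosed_eq (by fun_prop) (by fun_prop)) (fun x y z => ?_) x y z
    simp only [← ofPre_mul, mul_assoc]

instance : StarRing p.Completion where
  star_involutive x := by
    refine (denseRange_ofPre p).induction_on (p := fun x => star (star x) = x) x
      (isClosed_eq (by fun_prop) (by fun_prop)) (fun x => ?_)
    simp only [← ofPre_star, star_star]
  star_mul x y := by
    refine (denseRange_ofPre p).induction_on₂ (p := fun x y => star (x * y) = star y * star x)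
      (isClosed_eq (by fun_prop) (by fun_prop)) (fun x y => ?_) x y
    simp only [← ofPre_star, ← ofPre_mul, star_mul]
  star_add x y := by
    refine (denseRange_ofPre p).induction_on₂ (p := fun x y => star (x + y) = star x + star y)
      (isClosed_eq (by fun_prop) (by fun_prop)) (fun x y => ?_) x y
    simp only [← ofPre_star, ← map_add, star_add]

instance : IsScalarTower ℂ p.Completion p.Completion := ⟨fun c x y => by
  change mulCLM p (c • x) y = c • mulCLM p x y
  rw [map_smul, smul_apply]⟩

instance : SMulCommClass ℂ p.Completion p.Completion := ⟨fun c x y => by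
  change c • mulCLM p x y = mulCLM p x (c • y)
  rw [map_smul]⟩

instance : StarModule ℂ p.Completion := ⟨fun c x => by
  refine (denseRange_ofPre p).induction_on (p := fun x => star (c • x) = star c • star x) x
    (isClosed_eq ((continuous_const_smul c).star)
      ((continuous_id.star).const_smul (star c))) (fun x => ?_)
  rw [← map_smul, ← ofPre_star, ← ofPre_star, ← map_smul, star_smul]⟩

instance : NonUnitalNormedRing p.Completion where
  toNorm := inferInstance
  toNonUnitalRing := inferInstance
  toMetricSpace := inferInstance
  dist_eq := NormedAddCommGroup.dist_eq
  norm_mul_le x y := by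
    refine (denseRange_ofPre p).induction_on₂ (p := fun x y => ‖x * y‖ ≤ ‖x‖ * ‖y‖)
      (isClosed_le (by fun_prop) (by fun_prop)) (fun x y => ?_) x y
    simp only [← ofPre_mul, norm_ofPre, norm_mul_le]

/-- The completion of a *-algebra with respect to a C*-seminorm is a C*-algebra. -/
instance : NonUnitalCStarAlgebra p.Completion where
  norm_mul_self_le x := by
    refine (denseRange_ofPre p).induction_on (p := fun x => ‖x‖ * ‖x‖ ≤ ‖star x * x‖) x
      (isClosed_le (by fun_prop) (by fun_prop)) (fun x => ?_)
    simp only [← ofPre_mul, ← ofPre_star, norm_ofPre, pre_norm_star_mul_self, le_refl]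

end Completion

/-- The completion, as a bundled C*-algebra. -/
def completion : CStarAlg.{u} := ⟨p.Completion⟩

/-- The canonical *-homomorphism from `R` to the completion. -/
def toCompletion : R →⋆ₙₐ[ℂ] p.completion where
  toFun := Completion.ofPre p
  map_smul' c x := (Completion.ofPre p).map_smul c x
  map_zero' := (Completion.ofPre p).map_zero
  map_add' := (Completion.ofPre p).map_add
  map_mul' := Completion.ofPre_mul p
  map_star' := Completion.ofPre_star p

theorem norm_toCompletion (x : R) : ‖p.toCompletion x‖ = p.toSeminorm x :=
  Completion.norm_ofPre p x

theorem denseRange_toCompletion : DenseRange p.toCompletion := Completion.denseRange_ofPre p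

theorem isUniformInducing_toCompletion : IsUniformInducing (Completion.ofPre p) :=
  Completion.isUniformInducing_ofPre p

/-- A *-homomorphism `φ` from `R` to a C*-algebra with `‖φ x‖ ≤ p x` extends to the completion. -/
def lift {B : CStarAlg.{u}} (φ : R →⋆ₙₐ[ℂ] B) (hφ : ∀ x, ‖φ x‖ ≤ p.toSeminorm x) :
    p.completion ⟶ B :=
  let φ₀ : p.Pre →L[ℂ] B := LinearMap.mkContinuous (φ : R →ₗ[ℂ] B) 1 fun x => by
    rw [one_mul]; exact hφ x
  let Φ : p.Completion →L[ℂ] B := φ₀.extend (Completion.ofPre p)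
  have hΦ : ∀ x : p.Pre, Φ (Completion.ofPre p x) = φ x := fun x =>
    ContinuousLinearMap.extend_eq _ (Completion.denseRange_ofPre p)
      (Completion.isUniformInducing_ofPre p) x
  ⟨{ toFun := Φ
     map_smul' := Φ.map_smul
     map_zero' := Φ.map_zero
     map_add' := Φ.map_add
     map_mul' := fun x y => by
      refine (Completion.denseRange_ofPre p).induction_on₂
        (p := fun x y => Φ (x * y) = Φ x * Φ y)
        (isClosed_eq (by fun_prop) (by fun_prop)) (fun x y => ?_) x y
      rw [← Completion.ofPre_mul, hΦ, hΦ, hΦ]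
      exact map_mul φ x y
     map_star' := fun x => by
      refine (Completion.denseRange_ofPre p).induction_on
        (p := fun x => Φ (star x) = star (Φ x)) x
        (isClosed_eq (by fun_prop) (by fun_prop)) (fun x => ?_)
      rw [← Completion.ofPre_star, hΦ, hΦ]
      exact map_star φ x }⟩

@[simp] theorem lift_toCompletion {B : CStarAlg.{u}} (φ : R →⋆ₙₐ[ℂ] B)
    (hφ : ∀ x, ‖φ x‖ ≤ p.toSeminorm x) (x : R) :
    (p.lift φ hφ).hom (p.toCompletion x) = φ x :=
  ContinuousLinearMap.extend_eq _ (Completion.denseRange_ofPre p)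
    (Completion.isUniformInducing_ofPre p) x

theorem completion_hom_ext {B : CStarAlg.{u}} {f g : p.completion ⟶ B}
    (h : ∀ x, f.hom (p.toCompletion x) = g.hom (p.toCompletion x)) : f = g := by
  ext y
  exact congrFun (p.denseRange_toCompletion.equalizer
    (NonUnitalStarAlgHom.instContinuousLinearMapClassComplex.map_continuous f.hom)
    (NonUnitalStarAlgHom.instContinuousLinearMapClassComplex.map_continuous g.hom) (funext h)) y

end

end CStarSeminorm

/-! ### The regular representations -/

namespace AlgCrossedProduct

noncomputable section

variable {G : Type u} [Group G] {A B C : GCStarAlg G}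

/-- A representation of the C*-algebra `A` on a Hilbert space. -/
structure HilbertRep (A : CStarAlg.{u}) where
  H : Type u
  [normed : NormedAddCommGroup H]
  [inner : InnerProductSpace ℂ H]
  [complete : CompleteSpace H]
  rep : A →⋆ₙₐ[ℂ] (H →L[ℂ] H)

attribute [instance] HilbertRep.normed HilbertRep.inner HilbertRep.complete

variable (π : HilbertRep A.toCStarAlg)

/-- The Hilbert space `ℓ²(G, H)`. -/
abbrev L2 (π : HilbertRep A.toCStarAlg) : Type u := lp (fun _ : G => π.H) 2

theorem norm_rep_le (a : A) (x : π.H) : ‖π.rep a x‖ ≤ ‖a‖ * ‖x‖ :=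
  (π.rep a).le_of_opNorm_le (NonUnitalStarAlgHom.norm_apply_le π.rep a) x

theorem hasSum_regular (s : G) (ξ : L2 π) :
    HasSum (fun g => ‖ξ (s⁻¹ * g)‖ ^ (2 : ℝ)) (‖ξ‖ ^ (2 : ℝ)) := by
  have h := lp.hasSum_norm (p := 2) (by simp) ξ
  simp only [ENNReal.toReal_ofNat] at h
  exact (Equiv.hasSum_iff (Equiv.mulLeft s⁻¹)).2 h

theorem regular_le (s : G) (a : A) (ξ : L2 π) (g : G) :
    ‖π.rep (A.action g⁻¹ a) (ξ (s⁻¹ * g))‖ ^ (2 : ℝ) ≤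
      ‖a‖ ^ (2 : ℝ) * ‖ξ (s⁻¹ * g)‖ ^ (2 : ℝ) := by
  rw [← Real.mul_rpow (norm_nonneg _) (norm_nonneg _)]
  refine Real.rpow_le_rpow (norm_nonneg _) ?_ (by norm_num)
  exact (norm_rep_le π _ _).trans (by rw [GCStarAlg.norm_action])

theorem memℓp_regular (s : G) (a : A) (ξ : L2 π) :
    Memℓp (E := fun _ : G => π.H) (fun g => π.rep (A.action g⁻¹ a) (ξ (s⁻¹ * g))) 2 := by
  refine memℓp_gen ?_
  simp only [ENNReal.toReal_ofNat]
  exact Summable.of_nonneg_of_le (fun g => by positivity) (regular_le π s a ξ)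
    ((hasSum_regular π s ξ).summable.mul_left _)

/-- The operator `ξ ↦ (g ↦ π(α_{g⁻¹}(a)) ξ(s⁻¹ g))` on `ℓ²(G, H)`, that is the product of the image
of `a` and of the left translation by `s` in the regular representation induced by `π`. -/
def regularOp (s : G) (a : A) : L2 π →L[ℂ] L2 π :=
  LinearMap.mkContinuous
    { toFun := fun ξ => ⟨fun g => π.rep (A.action g⁻¹ a) (ξ (s⁻¹ * g)), memℓp_regular π s a ξ⟩
      map_add' := fun ξ η => by
        ext g
        exact map_add (π.rep (A.action g⁻¹ a)) _ _
      map_smul' := fun c ξ => by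
        ext g
        exact map_smul (π.rep (A.action g⁻¹ a)) c _ }
    ‖a‖ fun ξ => by
      refine lp.norm_le_of_tsum_le (by simp) (by positivity) ?_
      simp only [ENNReal.toReal_ofNat]
      rw [Real.mul_rpow (norm_nonneg _) (norm_nonneg _), ← (hasSum_regular π s ξ).tsum_eq,
        ← tsum_mul_left]
      exact Summable.tsum_le_tsum (regular_le π s a ξ)
        (Summable.of_nonneg_of_le (fun g => by positivity) (regular_le π s a ξ)
          ((hasSum_regular π s ξ).summable.mul_left _))
        ((hasSum_regular π s ξ).summable.mul_left _)

theorem regularOp_apply (s : G) (a : A) (ξ : L2 π) (g : G) :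
    regularOp π s a ξ g = π.rep (A.action g⁻¹ a) (ξ (s⁻¹ * g)) := rfl

/-- `regularOp` as a linear map in the coefficient. -/
def regularLin (s : G) : A →ₗ[ℂ] (L2 π →L[ℂ] L2 π) where
  toFun := regularOp π s
  map_add' a b := by
    ext ξ g
    simp [regularOp_apply]
  map_smul' c a := by
    ext ξ g
    simp [regularOp_apply]

theorem regularLin_apply (s : G) (a : A) (ξ : L2 π) (g : G) :
    regularLin π s a ξ g = π.rep (A.action g⁻¹ a) (ξ (s⁻¹ * g)) := rfl

theorem regularLin_mul (s t : G) (a b : A) :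
    regularLin π (s * t) (a * A.action s b) = regularLin π s a * regularLin π t b := by
  ext ξ g
  rw [mul_apply_eq_comp, regularLin_apply, regularLin_apply, regularLin_apply,
    map_mul, map_mul, mul_apply_eq_comp, ← GCStarAlg.action_mul_apply, mul_inv_rev,
    mul_inv_rev, inv_inv, mul_assoc]

theorem regularLin_star (s : G) (a : A) :
    regularLin π s⁻¹ (A.action s⁻¹ (star a)) = star (regularLin π s a) := by
  rw [ContinuousLinearMap.star_eq_adjoint, ContinuousLinearMap.eq_adjoint_iff]
  intro ξ η
  rw [lp.inner_eq_tsum, lp.inner_eq_tsum,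
    ← Equiv.tsum_eq (Equiv.mulLeft s) fun g => inner ℂ (ξ g) (regularLin π s a η g)]
  refine tsum_congr fun g => ?_
  rw [regularLin_apply, Equiv.coe_mulLeft, regularLin_apply, inv_mul_cancel_left, inv_inv,
    ← GCStarAlg.action_mul_apply, mul_inv_rev, map_star, map_star,
    ContinuousLinearMap.star_eq_adjoint, ContinuousLinearMap.adjoint_inner_left]

/-- The regular representation of the algebraic crossed product on `ℓ²(G, H)` induced by a
representation `π` of `A` on `H`: `(f ξ)(g) = ∑_s π(α_{g⁻¹}(f(s))) ξ(s⁻¹ g)`. -/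
def regularRep : AlgCrossedProduct A →⋆ₙₐ[ℂ] (L2 π →L[ℂ] L2 π) :=
  lift (regularLin π) (regularLin_mul π) (regularLin_star π)

theorem regularRep_single (s : G) (a : A) : regularRep π (single s a) = regularLin π s a :=
  lift_single _ _ _ s a

end

end AlgCrossedProduct

/-! ### The maximal and the reduced crossed product -/

noncomputable section

variable {G : Type u} [Group G]

/-- The largest C*-seminorm on the algebraic crossed product: the supremum of the norms of the
images under all *-homomorphisms into C*-algebras. -/
def maxSeminorm (A : GCStarAlg G) : CStarSeminorm (AlgCrossedProduct A) :=
  haveI : Nonempty (Σ B : CStarAlg.{u}, AlgCrossedProduct A →⋆ₙₐ[ℂ] B) := ⟨A.toCStarAlg, 0⟩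
  CStarSeminorm.ofReps
    (ι := Σ B : CStarAlg.{u}, AlgCrossedProduct A →⋆ₙₐ[ℂ] B) (fun i => i.1) (fun i => i.2)
    fun f => (AlgCrossedProduct.exists_norm_le f).imp fun c hc => by
      rintro _ ⟨i, rfl⟩
      exact hc i.1 i.2

/-- The reduced C*-seminorm on the algebraic crossed product: the supremum of the norms of the
images under all regular representations. -/
def redSeminorm (A : GCStarAlg G) : CStarSeminorm (AlgCrossedProduct A) :=
  haveI : Nonempty (AlgCrossedProduct.HilbertRep A.toCStarAlg) := ⟨⟨PUnit, 0⟩⟩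
  CStarSeminorm.ofReps
    (ι := AlgCrossedProduct.HilbertRep A.toCStarAlg)
    (fun π => ⟨AlgCrossedProduct.L2 π →L[ℂ] AlgCrossedProduct.L2 π⟩)
    (fun π => AlgCrossedProduct.regularRep π)
    fun f => (AlgCrossedProduct.exists_norm_le f).imp fun c hc => by
      rintro _ ⟨π, rfl⟩
      exact hc ⟨AlgCrossedProduct.L2 π →L[ℂ] AlgCrossedProduct.L2 π⟩
        (AlgCrossedProduct.regularRep π)

theorem le_maxSeminorm {A : GCStarAlg G} {B : CStarAlg.{u}}
    (φ : AlgCrossedProduct A →⋆ₙₐ[ℂ] B) (f : AlgCrossedProduct A) :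
    ‖φ f‖ ≤ (maxSeminorm A).toSeminorm f :=
  le_ciSup (f := fun i : Σ B : CStarAlg.{u}, AlgCrossedProduct A →⋆ₙₐ[ℂ] B => ‖i.2 f‖)
    ((AlgCrossedProduct.exists_norm_le f).imp fun c hc => by
      rintro _ ⟨i, rfl⟩
      exact hc i.1 i.2) ⟨B, φ⟩

theorem redSeminorm_map_le {A B : GCStarAlg G} (φ : A ⟶ B) (f : AlgCrossedProduct A) :
    (redSeminorm B).toSeminorm (AlgCrossedProduct.map φ f) ≤ (redSeminorm A).toSeminorm f := by
  refine Real.iSup_le (fun π => ?_) (apply_nonneg _ _)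
  let ρ : AlgCrossedProduct.HilbertRep A.toCStarAlg := ⟨π.H, π.rep.comp φ.hom⟩
  have h : AlgCrossedProduct.regularRep π (AlgCrossedProduct.map φ f) =
      AlgCrossedProduct.regularRep ρ f := by
    induction f using AlgCrossedProduct.induction with
    | zero => rw [map_zero, map_zero, map_zero]
    | add f₁ f₂ h₁ h₂ => rw [map_add, map_add, map_add, h₁, h₂]
    | single s a =>
      rw [AlgCrossedProduct.map_single, AlgCrossedProduct.regularRep_single,
        AlgCrossedProduct.regularRep_single]
      ext ξ g
      rw [AlgCrossedProduct.regularLin_apply, AlgCrossedProduct.regularLin_apply, ← φ.equivariant]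
      rfl
  rw [h]
  exact le_ciSup (f := fun π : AlgCrossedProduct.HilbertRep A.toCStarAlg =>
      ‖AlgCrossedProduct.regularRep π f‖)
    ((AlgCrossedProduct.exists_norm_le f).imp fun c hc => by
      rintro _ ⟨π, rfl⟩
      exact hc ⟨AlgCrossedProduct.L2 π →L[ℂ] AlgCrossedProduct.L2 π⟩
        (AlgCrossedProduct.regularRep π)) ρ

/-- The canonical map `κ_A` from the algebraic to the maximal crossed product. -/
def toMax (A : GCStarAlg G) : AlgCrossedProduct A →⋆ₙₐ[ℂ] (maxSeminorm A).completion :=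
  (maxSeminorm A).toCompletion

/-- The canonical map from the algebraic to the reduced crossed product. -/
def toRed (A : GCStarAlg G) : AlgCrossedProduct A →⋆ₙₐ[ℂ] (redSeminorm A).completion :=
  (redSeminorm A).toCompletion

theorem norm_toRed_map_le {A B : GCStarAlg G} (φ : A ⟶ B) (f : AlgCrossedProduct A) :
    ‖((toRed B).comp (AlgCrossedProduct.map φ)) f‖ ≤ (redSeminorm A).toSeminorm f :=
  ((redSeminorm B).norm_toCompletion _).le.trans (redSeminorm_map_le φ f)

/-- The *-homomorphism `φ ⋊_max G`, the continuous extension of `f ↦ φ ∘ f`. -/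
def maxMap {A B : GCStarAlg G} (φ : A ⟶ B) :
    (maxSeminorm A).completion ⟶ (maxSeminorm B).completion :=
  (maxSeminorm A).lift ((toMax B).comp (AlgCrossedProduct.map φ)) (le_maxSeminorm _)

/-- The *-homomorphism `φ ⋊_r G`, the continuous extension of `f ↦ φ ∘ f`. -/
def redMap {A B : GCStarAlg G} (φ : A ⟶ B) :
    (redSeminorm A).completion ⟶ (redSeminorm B).completion :=
  (redSeminorm A).lift ((toRed B).comp (AlgCrossedProduct.map φ)) (norm_toRed_map_le φ)

/-- The *-homomorphism from the maximal to the reduced crossed product which extends the identity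
of the algebraic crossed product. -/
def maxToRedMap (A : GCStarAlg G) : (maxSeminorm A).completion ⟶ (redSeminorm A).completion :=
  (maxSeminorm A).lift (toRed A) (le_maxSeminorm _)

@[simp] theorem maxMap_toMax {A B : GCStarAlg G} (φ : A ⟶ B) (f : AlgCrossedProduct A) :
    (maxMap φ).hom (toMax A f) = toMax B (AlgCrossedProduct.map φ f) :=
  CStarSeminorm.lift_toCompletion _ _ _ f

@[simp] theorem redMap_toRed {A B : GCStarAlg G} (φ : A ⟶ B) (f : AlgCrossedProduct A) :
    (redMap φ).hom (toRed A f) = toRed B (AlgCrossedProduct.map φ f) :=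
  CStarSeminorm.lift_toCompletion _ _ _ f

@[simp] theorem maxToRedMap_toMax (A : GCStarAlg G) (f : AlgCrossedProduct A) :
    (maxToRedMap A).hom (toMax A f) = toRed A f :=
  CStarSeminorm.lift_toCompletion _ _ _ f

theorem max_hom_ext {A : GCStarAlg G} {B : CStarAlg.{u}} {φ ψ : (maxSeminorm A).completion ⟶ B}
    (h : ∀ f, φ.hom (toMax A f) = ψ.hom (toMax A f)) : φ = ψ :=
  CStarSeminorm.completion_hom_ext _ h

theorem red_hom_ext {A : GCStarAlg G} {B : CStarAlg.{u}} {φ ψ : (redSeminorm A).completion ⟶ B}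
    (h : ∀ f, φ.hom (toRed A f) = ψ.hom (toRed A f)) : φ = ψ :=
  CStarSeminorm.completion_hom_ext _ h

theorem map_id_apply {A : GCStarAlg G} (f : AlgCrossedProduct A) :
    AlgCrossedProduct.map (𝟙 A) f = f := by
  ext s; simp

theorem map_comp_apply {A B C : GCStarAlg G} (φ : A ⟶ B) (ψ : B ⟶ C) (f : AlgCrossedProduct A) :
    AlgCrossedProduct.map (φ ≫ ψ) f = AlgCrossedProduct.map ψ (AlgCrossedProduct.map φ f) := by
  ext s; simp

variable (G)

/-- The maximal crossed product functor `A ↦ A ⋊_max G`. -/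
def maxCrossedProduct : GCStarAlg G ⥤ CStarAlg.{u} where
  obj A := (maxSeminorm A).completion
  map φ := maxMap φ
  map_id A := max_hom_ext fun f => by simp [map_id_apply]
  map_comp φ ψ := max_hom_ext fun f => by simp [map_comp_apply]

/-- The reduced crossed product functor `A ↦ A ⋊_r G`. -/
def redCrossedProduct : GCStarAlg G ⥤ CStarAlg.{u} where
  obj A := (redSeminorm A).completion
  map φ := redMap φ
  map_id A := red_hom_ext fun f => by simp [map_id_apply]
  map_comp φ ψ := red_hom_ext fun f => by simp [map_comp_apply]

/-- The natural transformation `Λ` from the maximal to the reduced crossed product which extends the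
identity of the algebraic crossed product. -/
def maxToRed : maxCrossedProduct G ⟶ redCrossedProduct G where
  app A := maxToRedMap A
  naturality A B φ := by
    change maxMap φ ≫ maxToRedMap B = maxToRedMap A ≫ redMap φ
    exact max_hom_ext fun f => by simp

/-! ### Crossed product functors -/

/-- A crossed product functor `A ↦ A ⋊_μ G`: a functor from `G`-C*-algebras to C*-algebras with
natural transformations `q : - ⋊_max G → - ⋊_μ G` and `s : - ⋊_μ G → - ⋊_r G` that consist of
surjective *-homomorphisms and satisfy `s ∘ q = Λ`. -/
structure CrossedProductFunctor where
  functor : GCStarAlg G ⥤ CStarAlg.{u}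
  q : maxCrossedProduct G ⟶ functor
  s : functor ⟶ redCrossedProduct G
  q_surjective : ∀ A, Function.Surjective (q.app A).hom
  s_surjective : ∀ A, Function.Surjective (s.app A).hom
  q_comp_s : q ≫ s = maxToRed G

namespace CrossedProductFunctor

variable {G} (F : CrossedProductFunctor G)

/-- The canonical *-homomorphism `q ∘ κ` from `A ⋊_alg G` to `A ⋊_μ G`. -/
def ofAlg (A : GCStarAlg G) : AlgCrossedProduct A →⋆ₙₐ[ℂ] F.functor.obj A :=
  (F.q.app A).hom.comp (toMax A)

/-- `F` has the cp-map property, that is `F` is a correspondence crossed product functor: every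
`G`-equivariant completely positive map `φ : A → B` induces a completely positive map
`A ⋊_μ G → B ⋊_μ G` which sends `f` to `φ ∘ f` for every `f` in the algebraic crossed product. -/
def IsCorrespondence : Prop :=
  ∀ (A B : GCStarAlg G)
    (φ : CompletelyPositiveMap A.toCStarAlg B.toCStarAlg),
    (∀ (g : G) (a : A), φ (A.action g a) = B.action g (φ a)) →
    ∃ Φ : CompletelyPositiveMap (F.functor.obj A) (F.functor.obj B),
      ∀ f : AlgCrossedProduct A,
        Φ (F.ofAlg A f) = F.ofAlg B (AlgCrossedProduct.mapLin φ.toLinearMap f)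

/-- `F` is exact: it maps the short exact sequences `0 → I → A → A/I → 0` of `G`-C*-algebras to
short exact sequences. -/
def IsExact : Prop :=
  ∀ {I A Q : GCStarAlg G} (i : I ⟶ A) (p : A ⟶ Q), GCStarAlg.IsShortExact i p →
    CStarAlg.IsShortExact (F.functor.map i) (F.functor.map p)

/-- `F` is exact for trivial actions. -/
def IsExactForTrivialActions : Prop :=
  ∀ {I A Q : GCStarAlg G} (i : I ⟶ A) (p : A ⟶ Q), I.IsTrivial → A.IsTrivial → Q.IsTrivial →
    GCStarAlg.IsShortExact i p → CStarAlg.IsShortExact (F.functor.map i) (F.functor.map p)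

/-- The functor `A ↦ A ⊗_μ C*_μ(G)`, which is by definition `A ⋊_μ G` with `G` acting trivially
on `A`. -/
def tensorFunctor : CStarAlg.{u} ⥤ CStarAlg.{u} := GCStarAlg.trivialAction G ⋙ F.functor

end CrossedProductFunctor

end

/-- A functor on the category of C*-algebras is exact: it preserves short exact sequences. -/
def CStarAlg.IsExactFunctor (T : CStarAlg.{u} ⥤ CStarAlg.{u}) : Prop :=
  ∀ {I A Q : CStarAlg.{u}} (i : I ⟶ A) (p : A ⟶ Q), CStarAlg.IsShortExact i p →
    CStarAlg.IsShortExact (T.map i) (T.map p)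

/-! The substance is that exactness for trivial actions implies exactness. The link is the dual
coaction `δ_A : A ⋊_μ G → (A ⋊_max G) ⊗_μ C*_μ(G)`, `a δ_s ↦ (a δ_s) ⊗ δ_s`, whose target is a
crossed product by a trivial action. It is natural in `A`, and for a correspondence functor it is
isometric (`IsCorrespondence.norm_dualCoaction`).

Isometry is proved in a linking algebra. Put `D = A ⋊_max G` with its unitary multipliers `u_s`, and
let `G` act on `M₂(D)` by conjugation with `diag(u_s, 1)`. The upper left corner contains `A` with
its own action, because `u_s a u_s* = α_s(a)`; the lower right corner is `D` with the trivial
action. Both inclusions have equivariant completely positive retractions: compression to the corner,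
followed in the first case by the conditional expectation `f ↦ f(1)`. By the cp-map property both
inclusions stay isometric after `⋊_μ G` (`IsCorrespondence.norm_map`). Multiplying by off-diagonal
matrices whose entry runs through an approximate unit of `D` carries `f` in the first corner to
`δ_A(f)` in the second, and back; these factors are contractions, so the two norms agree.

Given `0 → I → A → Q → 0`, the maximal crossed product is exact (`isShortExact_maxMap`), and
tensoring with `C*_μ(G)` preserves this by hypothesis. Injectivity of `I ⋊_μ G → A ⋊_μ G` follows by
naturality from the isometry of `δ_I`. If `x ∈ A ⋊_μ G` dies in `Q ⋊_μ G`, then `δ_A(x)` lies in the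
image of `(I ⋊_max G) ⊗_μ C*_μ(G)`, so an approximate unit `(e)` of `I` satisfies `δ_A(e x) →
δ_A(x)`. Hence `e x → x`, and every `e x` lies in the closed image of `I ⋊_μ G`. Surjectivity is
inherited from the maximal crossed product. -/

/-! ### Extension of bounded linear maps -/

namespace CStarAlg

variable {R : Type*} [AddCommGroup R] [Module ℂ R] {D E : CStarAlg.{u}}

/-- The continuous extension of the linear map `f` along the linear map `e` with dense range. -/
noncomputable def extend (f : R →ₗ[ℂ] E) (e : R →ₗ[ℂ] D) : D →L[ℂ] E :=
  LinearMap.extendOfNorm (Eₗ := D) (F := E) f e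

/-- The bound makes `f` vanish on the kernel of `e`, so `f` factors through the range of `e` as a
contraction. -/
theorem extend_apply {f : R →ₗ[ℂ] E} {e : R →ₗ[ℂ] D} (he : DenseRange e)
    (h : ∀ x, ‖f x‖ ≤ ‖e x‖) (x : R) : extend f e (e x) = f x :=
  LinearMap.extendOfNorm_eq (Eₗ := D) (F := E) he ⟨1, by simpa using h⟩ x

end CStarAlg

/-! ### Bounds for the maximal C*-seminorm -/

noncomputable section MaxSeminorm

open Filter Topology

variable {G : Type u} [Group G] {A B : GCStarAlg G}

/-- The completion for `p` is one of the C*-algebras over which the supremum is taken. This turns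
the universal property of the maximal norm into a method: to bound a norm by the maximal one, show
that it is a C*-seminorm. -/
theorem CStarSeminorm.le_maxSeminorm (p : CStarSeminorm (AlgCrossedProduct A))
    (f : AlgCrossedProduct A) : p.toSeminorm f ≤ (maxSeminorm A).toSeminorm f :=
  (p.norm_toCompletion f).symm.le.trans (_root_.le_maxSeminorm p.toCompletion f)

theorem norm_toMax (f : AlgCrossedProduct A) : ‖toMax A f‖ = (maxSeminorm A).toSeminorm f :=
  (maxSeminorm A).norm_toCompletion f

theorem denseRange_toMax : DenseRange (toMax A) := (maxSeminorm A).denseRange_toCompletion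

/-- A C*-seminorm from a seminorm with the C*-inequality for `x * star x`. -/
def CStarSeminorm.ofLe {R : Type u} [NonUnitalRing R] [StarRing R] [Module ℂ R]
    (p : Seminorm ℂ R) (hmul : ∀ x y, p (x * y) ≤ p x * p y)
    (hstar : ∀ x, p x * p x ≤ p (x * star x)) : CStarSeminorm R where
  toSeminorm := p
  mul_le' := hmul
  star_mul_self' x := by
    change p (star x * x) = p x * p x
    have key : ∀ x, p x ≤ p (star x) := fun x => by
      by_contra! h
      have h1 : p x * p x ≤ p x * p (star x) := (hstar x).trans (hmul _ _)
      exact absurd (le_of_mul_le_mul_left h1 ((apply_nonneg p _).trans_lt h)) (not_le.2 h)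
    have h : p (star x) = p x := le_antisymm (by simpa using key (star x)) (key x)
    refine le_antisymm ((hmul _ _).trans_eq (by rw [h])) ?_
    have := hstar (star x)
    rwa [star_star, h] at this

/-- Right actions of the algebraic crossed product which satisfy a C*-inequality are bounded by the
maximal C*-seminorm. -/
theorem norm_apply_le_maxSeminorm {X : Type*} [SeminormedAddCommGroup X] [NormedSpace ℂ X]
    (ρ : AlgCrossedProduct A →ₗ[ℂ] X →ₗ[ℂ] X)
    (hb : ∀ s a, ∃ C, ∀ x, ‖ρ (AlgCrossedProduct.single s a) x‖ ≤ C * ‖x‖)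
    (hmul : ∀ f g x, ρ (f * g) x = ρ g (ρ f x))
    (hstar : ∀ f x, ‖ρ f x‖ * ‖ρ f x‖ ≤ ‖ρ (f * star f) x‖ * ‖x‖)
    (f : AlgCrossedProduct A) (x : X) :
    ‖ρ f x‖ ≤ (maxSeminorm A).toSeminorm f * ‖x‖ := by
  have hb' : ∀ f, ∃ C, ∀ x, ‖ρ f x‖ ≤ C * ‖x‖ := fun f => by
    induction f using AlgCrossedProduct.induction with
    | zero => exact ⟨0, by simp⟩
    | single s a => exact hb s a
    | add f g hf hg =>
      obtain ⟨C, hC⟩ := hf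
      obtain ⟨D, hD⟩ := hg
      refine ⟨C + D, fun x => ?_⟩
      rw [map_add, LinearMap.add_apply, add_mul]
      exact norm_add_le_of_le (hC x) (hD x)
  let ρ' : AlgCrossedProduct A →ₗ[ℂ] X →L[ℂ] X :=
    { toFun := fun f => (ρ f).mkContinuousOfExistsBound (hb' f)
      map_add' := fun f g => by ext x; simp
      map_smul' := fun c f => by ext x; simp }
  have hρ' : ∀ f x, ρ' f x = ρ f x := fun _ _ => rfl
  -- The operator norm on `X` is a C*-seminorm although `X` carries no adjoints: `hstar` replaces
  -- them. A right action reverses products, which submultiplicativity of the norm does not notice.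
  let p : CStarSeminorm (AlgCrossedProduct A) := CStarSeminorm.ofLe
    ((normSeminorm ℂ (X →L[ℂ] X)).comp ρ')
    (fun f g => by
      refine (ρ' (f * g)).opNorm_le_bound (by positivity) fun x => ?_
      rw [hρ', hmul, ← hρ', ← hρ']
      calc _ ≤ ‖ρ' g‖ * (‖ρ' f‖ * ‖x‖) :=
            (ρ' g).le_opNorm_of_le ((ρ' f).le_opNorm x)
        _ = ‖ρ' f‖ * ‖ρ' g‖ * ‖x‖ := by ring)
    (fun f => by
      have h : ‖ρ' f‖ ≤ √‖ρ' (f * star f)‖ := by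
        refine (ρ' f).opNorm_le_bound (Real.sqrt_nonneg _) fun x => ?_
        refine abs_le_of_sq_le_sq' ?_ (by positivity) |>.2
        rw [mul_pow, Real.sq_sqrt (norm_nonneg _), sq, sq, ← mul_assoc]
        exact (hstar f x).trans
          (mul_le_mul_of_nonneg_right ((ρ' (f * star f)).le_opNorm x) (norm_nonneg _))
      calc ‖ρ' f‖ * ‖ρ' f‖ ≤ _ := mul_self_le_mul_self (norm_nonneg _) h
        _ = _ := Real.mul_self_sqrt (norm_nonneg _))
  exact ((ρ' f).le_opNorm x).trans
    (mul_le_mul_of_nonneg_right (p.le_maxSeminorm f) (norm_nonneg _))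

/-- The inclusion of `A` into the algebraic crossed product. -/
def AlgCrossedProduct.singleHom (A : GCStarAlg G) : A →⋆ₙₐ[ℂ] AlgCrossedProduct A where
  toFun := AlgCrossedProduct.single 1
  map_smul' c a := by simp
  map_zero' := by simp
  map_add' a b := by simp
  map_mul' a b := by
    rw [AlgCrossedProduct.single_mul_single, GCStarAlg.action_one_apply, one_mul]
  map_star' a := by
    rw [AlgCrossedProduct.star_single, inv_one, GCStarAlg.action_one_apply]

/-- For `s = 1` a *-homomorphism is contractive; the general case follows from `(a δ_s)* (a δ_s) =
α_{s⁻¹}(a* a) δ_1` and the C*-identity. -/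
theorem maxSeminorm_single_le (s : G) (a : A) :
    (maxSeminorm A).toSeminorm (AlgCrossedProduct.single s a) ≤ ‖a‖ := by
  have key : ∀ a : A, (maxSeminorm A).toSeminorm (AlgCrossedProduct.single 1 a) ≤ ‖a‖ :=
    fun a => by
    rw [← norm_toMax]
    exact NonUnitalStarAlgHom.norm_apply_le ((toMax A).comp (AlgCrossedProduct.singleHom A)) a
  have h := key (A.action s⁻¹ (star a * a))
  have h2 : star (AlgCrossedProduct.single s a) * AlgCrossedProduct.single s a =
      AlgCrossedProduct.single 1 (A.action s⁻¹ (star a * a)) := by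
    rw [AlgCrossedProduct.star_single, AlgCrossedProduct.single_mul_single, ← map_mul,
      inv_mul_cancel]
  rw [← h2, GCStarAlg.norm_action, CStarRing.norm_star_mul_self] at h
  have h3 := (maxSeminorm A).star_mul_self' (AlgCrossedProduct.single s a)
  refine abs_le_of_sq_le_sq' ?_ (norm_nonneg _) |>.2
  rw [sq, sq]
  exact h3.symm.le.trans h

end MaxSeminorm

/-! ### The Hilbert module `ℓ²(G, A)` and the conditional expectation -/

noncomputable section CondExp

open Filter Topology

variable {G : Type u} [Group G] {A B : GCStarAlg G}

namespace AlgCrossedProduct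

theorem single_one_mul_apply (a : A) (f : AlgCrossedProduct A) (s : G) :
    (single 1 a * f) s = a * f s := by
  classical
  induction f using induction with
  | zero => simp
  | add f g hf hg => rw [mul_add, add_apply, hf, hg, add_apply, mul_add]
  | single t b =>
    rw [single_mul_single, one_mul, single_apply, single_apply, GCStarAlg.action_one_apply]
    split_ifs <;> simp

theorem mul_single_one_apply (a : A) (f : AlgCrossedProduct A) (s : G) :
    (f * single 1 a) s = f s * A.action s a := by
  classical
  induction f using induction with
  | zero => simp
  | add f g hf hg => rw [add_mul, add_apply, hf, hg, add_apply, add_mul]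
  | single t b =>
    rw [single_mul_single, mul_one, single_apply, single_apply]
    split_ifs with h <;> simp [h]

theorem hasFiniteSupport (f : AlgCrossedProduct A) : (Function.support f).Finite :=
  Finsupp.hasFiniteSupport (f : G →₀ A)

theorem mul_star_apply_one (f g : AlgCrossedProduct A) {T : Finset G}
    (hT : Function.support f ⊆ T) : (f * star g) 1 = ∑ s ∈ T, f s * star (g s) := by
  rw [mul_apply, finsum_eq_sum_of_support_subset]
  · refine Finset.sum_congr rfl fun s _ => ?_
    rw [star_apply, ← GCStarAlg.action_mul_apply]
    simp
  · refine fun s hs => hT fun h => hs ?_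
    simp [h]

theorem star_apply_one (f : AlgCrossedProduct A) : star f 1 = star (f 1) := by
  rw [star_apply, inv_one, GCStarAlg.action_one_apply]

/-! The algebraic crossed product is a pre-Hilbert module over `A` with inner product
`⟨f, g⟩ = (g * star f)(1)`. -/

namespace HilbertModule

scoped instance : SMul A (AlgCrossedProduct A) := ⟨fun a f => single 1 a * f⟩
scoped instance : Inner A (AlgCrossedProduct A) := ⟨fun f g => (g * star f) 1⟩
scoped instance : Norm (AlgCrossedProduct A) := CStarModule.norm A

theorem inner_def (f g : AlgCrossedProduct A) : inner A f g = (g * star f) 1 := rfl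

theorem inner_self_eq_sum (f : AlgCrossedProduct A) :
    inner A f f = ∑ s ∈ f.hasFiniteSupport.toFinset, f s * star (f s) :=
  mul_star_apply_one f f (by simp)

scoped instance : CStarModule A (AlgCrossedProduct A) where
  inner_add_right {f g h} := by rw [inner_def, add_mul]; rfl
  inner_self_nonneg {f} := by
    rw [inner_self_eq_sum]
    exact Finset.sum_nonneg fun s _ => mul_star_self_nonneg _
  inner_self {f} := by
    refine ⟨fun h => ?_, fun h => by simp [h, inner_def]⟩
    rw [inner_self_eq_sum, Finset.sum_eq_zero_iff_of_nonneg fun s _ => mul_star_self_nonneg _] at h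
    ext s
    by_contra hs
    exact hs ((CStarRing.mul_star_self_eq_zero_iff _).1 (h s (by simpa using hs)))
  inner_op_smul_right {a f g} := by
    change (single 1 a * g * star f) 1 = a * (g * star f) 1
    rw [mul_assoc, single_one_mul_apply]
  inner_smul_right_complex {z f g} := by rw [inner_def, smul_mul_assoc]; rfl
  star_inner f g := by rw [inner_def, ← star_apply_one, star_mul, star_star]; rfl
  norm_eq_sqrt_norm_inner_self f := rfl

scoped instance : NormedAddCommGroup (AlgCrossedProduct A) := CStarModule.normedAddCommGroup A
scoped instance : NormedSpace ℂ (AlgCrossedProduct A) := .ofCore (CStarModule.normedSpaceCore A)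

theorem norm_mul_self (f : AlgCrossedProduct A) :
    ‖f‖ * ‖f‖ = ‖((f : AlgCrossedProduct A) * star (f : AlgCrossedProduct A)) 1‖ := by
  rw [← sq]
  exact CStarModule.norm_sq_eq A

open Classical in
theorem norm_apply_le (f : AlgCrossedProduct A) (s : G) : ‖(f : AlgCrossedProduct A) s‖ ≤ ‖f‖ := by
  refine abs_le_of_sq_le_sq' ?_ (norm_nonneg _) |>.2
  rw [sq, sq, norm_mul_self, ← CStarRing.norm_self_mul_star]
  rw [mul_star_apply_one (f : AlgCrossedProduct A) f
    -- Inserting `s` makes `f(s) f(s)*` a summand of `⟨f, f⟩` even when `f(s) = 0`.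
    (T := insert s f.hasFiniteSupport.toFinset) (fun t ht => by simp [Function.mem_support.1 ht])]
  refine CStarAlgebra.norm_le_norm_of_nonneg_of_le (mul_star_self_nonneg _) ?_
  exact Finset.single_le_sum (f := fun s => f s * star (f s)) (fun t _ => mul_star_self_nonneg _)
    (Finset.mem_insert_self _ _)

/-- Right multiplication on the Hilbert module. -/
def rightMul (A : GCStarAlg G) :
    AlgCrossedProduct A →ₗ[ℂ] AlgCrossedProduct A →ₗ[ℂ] AlgCrossedProduct A :=
  (LinearMap.mul ℂ (AlgCrossedProduct A)).flip

theorem rightMul_apply (f g : AlgCrossedProduct A) : rightMul A f g = g * f := rfl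

/-- With `b = a a*`, the inner square of `f · a δ_s` is `∑ f(t) α_t(b) f(t)*`, and each term is at
most `‖b‖ f(t) f(t)*`. -/
theorem norm_mul_single_le (s : G) (a : A) (f : AlgCrossedProduct A) :
    ‖rightMul A (single s a) f‖ ≤ ‖a‖ * ‖f‖ := by
  have h1 : single s a * star (single s a) = single 1 (a * star a) := by
    rw [star_single, single_mul_single, mul_inv_cancel, ← GCStarAlg.action_mul_apply,
      mul_inv_cancel, GCStarAlg.action_one_apply]
  refine abs_le_of_sq_le_sq' ?_ (by positivity) |>.2
  rw [mul_pow, sq, sq, sq, norm_mul_self, norm_mul_self, rightMul_apply, star_mul,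
    mul_assoc, ← mul_assoc _ _ (star (f : AlgCrossedProduct A)), h1, ← mul_assoc,
    ← CStarRing.norm_self_mul_star]
  set b := a * star a
  have hb : 0 ≤ b := mul_star_self_nonneg a
  have hT : Function.support f ⊆ f.hasFiniteSupport.toFinset := by simp
  rw [mul_star_apply_one (f : AlgCrossedProduct A) f hT, mul_star_apply_one (f * single 1 b) f
    (T := f.hasFiniteSupport.toFinset) (fun s hs => hT fun h => hs (by
      rw [mul_single_one_apply, h, zero_mul])), ← norm_norm b, ← norm_smul]
  have h2 : ∀ s : G, (f * single 1 b) s * star (f s) = f s * A.action s b * star (f s) :=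
    fun s => by rw [mul_single_one_apply]
  simp only [h2]
  have hb' : ∀ s, 0 ≤ A.action s b := fun s => by
    rw [map_mul, map_star]; exact mul_star_self_nonneg _
  refine CStarAlgebra.norm_le_norm_of_nonneg_of_le
    (Finset.sum_nonneg fun s _ => star_right_conjugate_nonneg (hb' s) _) ?_
  rw [Finset.smul_sum]
  refine Finset.sum_le_sum fun s _ => ?_
  rw [← GCStarAlg.norm_action A s b]
  exact CStarAlgebra.star_right_conjugate_le_norm_smul (hb := IsSelfAdjoint.of_nonneg (hb' s))

/-- The C*-inequality required of the right action is Cauchy–Schwarz in the Hilbert module, since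
`⟨x f, x f⟩ = ⟨x, x f f*⟩`. -/
theorem norm_rightMul_le (f : AlgCrossedProduct A) (x : AlgCrossedProduct A) :
    ‖rightMul A f x‖ ≤ (maxSeminorm A).toSeminorm f * ‖x‖ := by
  refine norm_apply_le_maxSeminorm (rightMul A) (fun s a => ⟨‖a‖, norm_mul_single_le s a⟩)
    (fun f g x => ?_) (fun f x => ?_) f x
  · simp only [rightMul_apply, mul_assoc]
  · rw [norm_mul_self, mul_comm]
    refine le_trans (le_of_eq ?_) (CStarModule.norm_inner_le (A := A) _ (x := x)
      (y := rightMul A (f * star f) x))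
    rw [rightMul_apply, rightMul_apply, inner_def, star_mul]
    simp only [mul_assoc]

end HilbertModule

open scoped HilbertModule in
-- For unital `A` one would apply right multiplication by `f` to the unit vector `δ_1`. In general
-- `e δ_1` replaces it, with `e` in an approximate unit: it has norm at most one, and its image
-- takes the value `e f(1)` at `1`.
theorem norm_apply_one_le (f : AlgCrossedProduct A) : ‖f 1‖ ≤ (maxSeminorm A).toSeminorm f := by
  have hl := CStarAlgebra.increasingApproximateUnit (A := A)
  refine le_of_tendsto (hl.tendsto_mul_right (f 1)).norm ?_
  filter_upwards [hl.eventually_norm] with e he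
  rw [← single_one_mul_apply]
  refine (HilbertModule.norm_apply_le (HilbertModule.rightMul A f (single 1 e)) 1).trans
    ((HilbertModule.norm_rightMul_le f _).trans (mul_le_of_le_one_right (apply_nonneg _ _) ?_))
  refine abs_le_of_sq_le_sq' ?_ zero_le_one |>.2
  rw [sq, sq, HilbertModule.norm_mul_self, single_one_mul_apply, star_apply_one, single_apply,
    if_pos rfl, CStarRing.norm_self_mul_star]
  gcongr

end AlgCrossedProduct

/-- The conditional expectation `f ↦ f(1)` from the maximal crossed product onto `A`. -/
def condExp (A : GCStarAlg G) : (maxSeminorm A).completion →L[ℂ] A :=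
  CStarAlg.extend
    { toFun := fun f : AlgCrossedProduct A => f 1
      map_add' := fun _ _ => rfl
      map_smul' := fun _ _ => rfl } (toMax A : AlgCrossedProduct A →ₗ[ℂ] (maxSeminorm A).completion)

theorem condExp_toMax (f : AlgCrossedProduct A) : condExp A (toMax A f) = f 1 :=
  CStarAlg.extend_apply denseRange_toMax
    (fun f => (AlgCrossedProduct.norm_apply_one_le f).trans (norm_toMax f).symm.le) f

end CondExp

/-! ### Exactness of the maximal crossed product -/

/-! ### Approximate units acting by multiplication. -/

section ApproximateUnit

open Filter Topology

/-- If `u i` are contractions and `u i * x → x` for all `x ∈ S`, then the same holds for all `x` in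
the closure of `S`. -/
theorem tendsto_mul_of_mem_closure {D ι : Type*} [NonUnitalSeminormedRing D] {l : Filter ι}
    {v : ι → D} (hv : ∀ᶠ i in l, ‖v i‖ ≤ 1) {S : Set D}
    (hS : ∀ x ∈ S, Tendsto (fun i => v i * x) l (𝓝 x)) {x : D} (hx : x ∈ closure S) :
    Tendsto (fun i => v i * x) l (𝓝 x) := by
  rw [Metric.tendsto_nhds]
  intro ε hε
  obtain ⟨y, hy, hxy⟩ := Metric.mem_closure_iff.1 hx (ε / 3) (by positivity)
  filter_upwards [hv, Metric.tendsto_nhds.1 (hS y hy) (ε / 3) (by positivity)] with i h1 h2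
  rw [dist_eq_norm] at *
  calc ‖v i * x - x‖ = ‖v i * (x - y) + (v i * y - y) + (y - x)‖ := by rw [mul_sub]; abel_nf
    _ ≤ ‖v i * (x - y)‖ + ‖v i * y - y‖ + ‖y - x‖ := norm_add₃_le
    _ ≤ 1 * ‖x - y‖ + ‖v i * y - y‖ + ‖x - y‖ := by
      rw [norm_sub_rev y x]
      gcongr
      exact (norm_mul_le _ _).trans (by gcongr)
    _ < ε := by linarith

/-- In the unitization `1 - e` is a positive contraction. -/
theorem norm_sub_mul_le_of_nonneg {D : Type*} [NonUnitalCStarAlgebra D] [PartialOrder D] [StarOrderedRing D]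
    {e : D} (he : 0 ≤ e) (he1 : ‖e‖ ≤ 1) (x : D) : ‖x - e * x‖ ≤ ‖x‖ := by
  have h0 : 0 ≤ (e : Unitization ℂ D) := Unitization.inr_nonneg_iff.2 he
  have h1 : (e : Unitization ℂ D) ≤ 1 :=
    (CStarAlgebra.norm_le_one_iff_of_nonneg _ h0).1 (by rwa [Unitization.norm_inr])
  have h2 : ‖1 - (e : Unitization ℂ D)‖ ≤ 1 :=
    (CStarAlgebra.norm_le_one_iff_of_nonneg _ (sub_nonneg.2 h1)).2 (sub_le_self _ h0)
  have h3 : ((x - e * x : D) : Unitization ℂ D) = (1 - (e : Unitization ℂ D)) * x := by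
    rw [sub_mul, one_mul, Unitization.inr_sub, Unitization.inr_mul]
  rw [← Unitization.norm_inr (𝕜 := ℂ), h3, ← Unitization.norm_inr (𝕜 := ℂ) (a := x)]
  exact (norm_mul_le _ _).trans (mul_le_of_le_one_left (norm_nonneg _) h2)

end ApproximateUnit

/-! ### Ideals: the algebraic sequence, and injectivity of `I ⋊_max G → A ⋊_max G`. -/

noncomputable section

open Filter Topology AlgCrossedProduct

variable {G : Type u} [Group G] {I A Q : GCStarAlg G} {i : I ⟶ A} {p : A ⟶ Q}

namespace GCStarAlg.IsShortExact

variable (h : GCStarAlg.IsShortExact i p)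
include h

theorem injective_hom : Function.Injective i.hom := h.1

theorem hom_eq_zero_iff (a : A) : p.hom a = 0 ↔ ∃ x, i.hom x = a := h.2 a

theorem surjective_hom : Function.Surjective p.hom := h.3

/-- A splitting that is only linear, neither bounded nor equivariant, is enough: it is applied
coefficientwise to finitely supported functions. -/
theorem exists_linear_leftInverse : ∃ r : A →ₗ[ℂ] I, ∀ x, r (i.hom x) = x := by
  obtain ⟨r, hr⟩ := LinearMap.exists_leftInverse_of_injective (i.hom : I →ₗ[ℂ] A)
    (LinearMap.ker_eq_bot.2 h.injective_hom)
  exact ⟨r, fun x => LinearMap.congr_fun hr x⟩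

theorem exists_linear_rightInverse : ∃ σ : Q →ₗ[ℂ] A, ∀ x, p.hom (σ x) = x := by
  obtain ⟨r, hr⟩ := LinearMap.exists_rightInverse_of_surjective (p.hom : A →ₗ[ℂ] Q)
    (LinearMap.range_eq_top.2 h.surjective_hom)
  exact ⟨r, fun x => LinearMap.congr_fun hr x⟩

theorem map_injective : Function.Injective (AlgCrossedProduct.map i) := fun f g hfg => by
  ext s
  apply h.injective_hom
  rw [← map_apply, hfg, map_apply]

theorem map_eq_zero_iff (f : AlgCrossedProduct A) :
    AlgCrossedProduct.map p f = 0 ↔ ∃ x, AlgCrossedProduct.map i x = f := by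
  constructor
  · intro hf
    obtain ⟨r, hr⟩ := h.exists_linear_leftInverse
    refine ⟨mapLin r f, ?_⟩
    ext s
    obtain ⟨x, hx⟩ := (h.hom_eq_zero_iff (f s)).1 (by rw [← map_apply, hf, AlgCrossedProduct.zero_apply])
    rw [map_apply, mapLin_apply, ← hx, hr]
  · rintro ⟨x, rfl⟩
    ext s
    rw [map_apply, map_apply, AlgCrossedProduct.zero_apply]
    exact (h.hom_eq_zero_iff _).2 ⟨_, rfl⟩

/-- The algebraic crossed product of `I` is an ideal in that of `A`; `ρ f x` is the product `x f`
read inside the ideal. -/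
theorem exists_right_mul : ∃ ρ : AlgCrossedProduct A →ₗ[ℂ] AlgCrossedProduct I →ₗ[ℂ]
    AlgCrossedProduct I, ∀ f x, AlgCrossedProduct.map i (ρ f x) = AlgCrossedProduct.map i x * f := by
  obtain ⟨r, hr⟩ := LinearMap.exists_leftInverse_of_injective
    (AlgCrossedProduct.map i : AlgCrossedProduct I →ₗ[ℂ] AlgCrossedProduct A)
    (LinearMap.ker_eq_bot.2 h.map_injective)
  refine ⟨((LinearMap.mul ℂ (AlgCrossedProduct A)).flip.compl₂
    (AlgCrossedProduct.map i : AlgCrossedProduct I →ₗ[ℂ] AlgCrossedProduct A)).compr₂ r,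
    fun f x => ?_⟩
  change AlgCrossedProduct.map i (r (AlgCrossedProduct.map i x * f)) = _
  obtain ⟨y, hy⟩ := (h.map_eq_zero_iff (AlgCrossedProduct.map i x * f)).1 (by
    rw [map_mul, (h.map_eq_zero_iff _).2 ⟨x, rfl⟩, zero_mul])
  rw [← hy]
  exact congrArg _ (LinearMap.congr_fun hr y)

/-- Right multiplication by `a δ_s` is bounded by `‖a‖` on the crossed product of an ideal. -/
theorem maxSeminorm_right_mul_single_le
    {ρ : AlgCrossedProduct A →ₗ[ℂ] AlgCrossedProduct I →ₗ[ℂ] AlgCrossedProduct I}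
    (hρ : ∀ f x, AlgCrossedProduct.map i (ρ f x) = AlgCrossedProduct.map i x * f)
    (s : G) (a : A) (x : AlgCrossedProduct I) :
    (maxSeminorm I).toSeminorm (ρ (single s a) x) ≤ ‖a‖ * (maxSeminorm I).toSeminorm x := by
  have hl := CStarAlgebra.increasingApproximateUnit (A := I)
  -- `i(I)` is the kernel of `p`, hence an ideal.
  have hideal : ∀ (y : I) (b : A), ∃ z : I, i.hom z = i.hom y * b := fun y b =>
    (h.hom_eq_zero_iff _).1 (by rw [map_mul, (h.hom_eq_zero_iff _).2 ⟨y, rfl⟩, zero_mul])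
  have hbound : ∀ t (b : I), ‖toMax I (ρ (single s a) (single t b))‖ ≤ ‖a‖ * ‖b‖ := fun t b => by
    obtain ⟨c, hc⟩ := hideal b (A.action t a)
    have h1 : ρ (single s a) (single t b) = single (t * s) c := h.map_injective (by
      rw [hρ, map_single, map_single, single_mul_single, hc])
    rw [h1, norm_toMax]
    refine (maxSeminorm_single_le _ _).trans ?_
    rw [← NonUnitalStarAlgHom.norm_map i.hom h.injective_hom c, hc, mul_comm]
    refine (norm_mul_le _ _).trans (le_of_eq ?_)
    rw [NonUnitalStarAlgHom.norm_map i.hom h.injective_hom, GCStarAlg.norm_action]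
  -- The factor `a δ_s` lies outside the crossed product of `I`, but `(e δ_1)(a δ_s) = (e a) δ_s`
  -- lies inside it. Inserting `e` therefore allows submultiplicativity of the norm of `I ⋊_max G`,
  -- with `‖e a‖ ≤ ‖a‖`; the limit over `e` removes it again.
  have key : Tendsto (fun e : I => toMax I (ρ (single s a) (x * single 1 e)))
      (CStarAlgebra.approximateUnit I) (𝓝 (toMax I (ρ (single s a) x))) := by
    induction x using AlgCrossedProduct.induction with
    | zero => simp
    | add f g hf hg => simpa only [add_mul, map_add] using hf.add hg
    | single t b =>
      rw [tendsto_iff_norm_sub_tendsto_zero]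
      have h2 : Tendsto (fun e : I => ‖a‖ * ‖b * I.action t e - b‖)
          (CStarAlgebra.approximateUnit I) (𝓝 0) := by
        -- Passing `e` across `δ_t` twists it by `α_t`; the isometry `α_{t⁻¹}` moves the twist onto
        -- the fixed element `b`.
        have h3 : ∀ e, ‖b * I.action t e - b‖ = ‖I.action t⁻¹ b * e - I.action t⁻¹ b‖ := fun e => by
          rw [← GCStarAlg.norm_action I t⁻¹, map_sub, map_mul, ← GCStarAlg.action_mul_apply I _ t,
            inv_mul_cancel, GCStarAlg.action_one_apply]
        simp only [h3]
        simpa using ((tendsto_iff_norm_sub_tendsto_zero.1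
          (hl.tendsto_mul_left (I.action t⁻¹ b))).const_mul ‖a‖)
      refine squeeze_zero (fun _ => norm_nonneg _) (fun e => ?_) h2
      rw [single_mul_single, mul_one, ← map_sub, ← map_sub, ← map_sub]
      exact hbound t _
  rw [← norm_toMax]
  refine le_of_tendsto key.norm ?_
  filter_upwards [hl.eventually_norm] with e he
  obtain ⟨c, hc⟩ := hideal e a
  have h1 : ρ (single s a) (x * single 1 e) = x * single s c := h.map_injective (by
    rw [hρ, map_mul, map_mul, map_single, map_single, mul_assoc, single_mul_single, hc,
      GCStarAlg.action_one_apply, one_mul])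
  rw [h1, norm_toMax, mul_comm ‖a‖]
  refine ((maxSeminorm I).mul_le' _ _).trans (mul_le_mul_of_nonneg_left ?_
    (apply_nonneg (maxSeminorm I).toSeminorm x))
  refine (maxSeminorm_single_le _ _).trans ?_
  rw [← NonUnitalStarAlgHom.norm_map i.hom h.injective_hom c, hc]
  refine (norm_mul_le _ _).trans (mul_le_of_le_one_left (norm_nonneg _) ?_)
  rwa [NonUnitalStarAlgHom.norm_map i.hom h.injective_hom]

/-- Right multiplication by the algebraic crossed product of `A` on that of `I` is bounded by the
maximal norm of `A`. Hence `‖x‖² = ‖x* x‖ ≤ ‖i(x)‖ ‖x*‖`, and one factor `‖x‖` cancels. -/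
theorem maxSeminorm_le (x : AlgCrossedProduct I) :
    (maxSeminorm I).toSeminorm x ≤ (maxSeminorm A).toSeminorm (AlgCrossedProduct.map i x) := by
  obtain ⟨ρ, hρ⟩ := h.exists_right_mul
  have hstar : ∀ y : AlgCrossedProduct I,
      (maxSeminorm I).toSeminorm (star y) = (maxSeminorm I).toSeminorm y :=
    CStarSeminorm.pre_norm_star (maxSeminorm I)
  have hmul : ∀ f g x, ρ (f * g) x = ρ g (ρ f x) := fun f g x => h.map_injective (by
    rw [hρ, hρ, hρ, mul_assoc])
  -- From `(x f)(x f)* = (x f f*) x*` and the C*-identity in the norm of `I`.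
  have hle : ∀ f x, (maxSeminorm I).toSeminorm (ρ f x) * (maxSeminorm I).toSeminorm (ρ f x) ≤
      (maxSeminorm I).toSeminorm (ρ (f * star f) x) * (maxSeminorm I).toSeminorm x := fun f x => by
    have h1 : ρ f x * star (ρ f x) = ρ (f * star f) x * star x := h.map_injective (by
      rw [map_mul, map_mul, map_star, hρ, hρ, star_mul, map_star]
      simp only [mul_assoc])
    have h2 := (maxSeminorm I).star_mul_self' (star (ρ f x))
    rw [star_star, h1] at h2
    rw [← hstar (ρ f x), ← hstar x]
    exact h2.symm.le.trans ((maxSeminorm I).mul_le' _ _)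
  have key : (maxSeminorm I).toSeminorm (ρ (AlgCrossedProduct.map i x) (star x)) ≤
      (maxSeminorm A).toSeminorm (AlgCrossedProduct.map i x) * (maxSeminorm I).toSeminorm (star x) :=
    norm_apply_le_maxSeminorm (X := (maxSeminorm I).Pre) ρ
      (fun s a => ⟨‖a‖, h.maxSeminorm_right_mul_single_le hρ s a⟩) hmul hle _ _
  have h1 : ρ (AlgCrossedProduct.map i x) (star x) = star x * x := h.map_injective (by
    rw [hρ, map_mul])
  rw [h1, hstar] at key
  have h2 : (maxSeminorm I).toSeminorm x * (maxSeminorm I).toSeminorm x ≤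
      (maxSeminorm A).toSeminorm (AlgCrossedProduct.map i x) * (maxSeminorm I).toSeminorm x :=
     ((maxSeminorm I).star_mul_self' x).symm.le.trans key
  rcases (apply_nonneg (maxSeminorm I).toSeminorm x).eq_or_lt with h0 | h0
  · rw [← h0]; exact apply_nonneg _ _
  · exact le_of_mul_le_mul_right h2 h0

theorem maxMap_injective : Function.Injective (maxMap i).hom := by
  have key : ∀ x, ‖x‖ ≤ ‖(maxMap i).hom x‖ := fun x => by
    have hc := NonUnitalStarAlgHom.instContinuousLinearMapClassComplex.map_continuous (maxMap i).hom
    refine denseRange_toMax.induction_on (p := fun x => ‖x‖ ≤ ‖(maxMap i).hom x‖) x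
      (isClosed_le continuous_norm hc.norm) fun f => ?_
    rw [maxMap_toMax, norm_toMax, norm_toMax]
    exact h.maxSeminorm_le f
  refine (injective_iff_map_eq_zero _).2 fun x hx => norm_le_zero_iff.1 ?_
  simpa [hx] using key x

end GCStarAlg.IsShortExact

end

/-! ### The quotient norm, exactness in the middle and surjectivity for `⋊_max`. -/

noncomputable section

open Filter Topology AlgCrossedProduct

variable {G : Type u} [Group G] {I A Q : GCStarAlg G} {i : I ⟶ A} {p : A ⟶ Q}

theorem CStarAlg.Hom.continuous {D E : CStarAlg.{u}} (φ : D ⟶ E) : Continuous φ.hom :=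
  NonUnitalStarAlgHom.instContinuousLinearMapClassComplex.map_continuous φ.hom

theorem continuous_toMax_single (A : GCStarAlg G) (s : G) :
    Continuous fun a : A => toMax A (single s a) :=
  (LinearMap.mkContinuous ((toMax A : AlgCrossedProduct A →ₗ[ℂ] (maxSeminorm A).completion) ∘ₗ
    single s) 1 fun a => by
      rw [one_mul]
      exact (norm_toMax _).le.trans (maxSeminorm_single_le s a)).continuous

/-- The norm of `f` in the quotient by `N`, as a seminorm. -/
def quotientSeminorm (A : GCStarAlg G) (N : Submodule ℂ (maxSeminorm A).completion) :
    Seminorm ℂ (AlgCrossedProduct A) :=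
  (normSeminorm ℂ ((maxSeminorm A).completion ⧸ N)).comp
    (N.mkQ ∘ₗ (toMax A : AlgCrossedProduct A →ₗ[ℂ] (maxSeminorm A).completion))

theorem quotientSeminorm_apply (N : Submodule ℂ (maxSeminorm A).completion)
    (f : AlgCrossedProduct A) : quotientSeminorm A N f = ‖N.mkQ (toMax A f)‖ := rfl

theorem Submodule.norm_mkQ_le {D : CStarAlg.{u}} (N : Submodule ℂ D) {x n : D} (hn : n ∈ N) :
    ‖N.mkQ x‖ ≤ ‖x + n‖ := by
  have h : N.mkQ x = N.mkQ (x + n) := by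
    rw [map_add, N.mkQ_apply n, (Submodule.Quotient.mk_eq_zero N).2 hn, add_zero]
  rw [h]
  exact Submodule.Quotient.norm_mk_le N (x + n)

theorem Submodule.exists_norm_add_lt {D : CStarAlg.{u}} (N : Submodule ℂ D) (x : D) {ε : ℝ}
    (hε : 0 < ε) : ∃ n ∈ N, ‖x + n‖ < ‖N.mkQ x‖ + ε := by
  obtain ⟨m, hm, h⟩ := Submodule.Quotient.norm_mk_lt (N.mkQ x) hε
  exact ⟨m - x, (Submodule.Quotient.eq N).1 hm, by rwa [add_sub_cancel]⟩

/-- An approximate unit of `I` is a left approximate unit of `I ⋊_max G`: on generators `(e δ_1)(b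
δ_s) = (e b) δ_s`, and contractivity passes this to the closure. -/
theorem tendsto_approximateUnit_mul_maxMap (i : I ⟶ A) (y : (maxSeminorm I).completion) :
    Tendsto (fun e : I => toMax A (single 1 (i.hom e)) * (maxMap i).hom y)
      (CStarAlgebra.approximateUnit I) (𝓝 ((maxMap i).hom y)) := by
  have hl := CStarAlgebra.increasingApproximateUnit (A := I)
  have hc := CStarAlg.Hom.continuous (maxMap i)
  have h1 : Tendsto (fun e : I => toMax I (single 1 e) * y)
      (CStarAlgebra.approximateUnit I) (𝓝 y) := by
    refine tendsto_mul_of_mem_closure (hl.eventually_norm.mono fun e he => ?_)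
      (S := Set.range (toMax I)) ?_ (denseRange_toMax y)
    · exact (norm_toMax _).le.trans ((maxSeminorm_single_le _ _).trans he)
    · rintro _ ⟨f, rfl⟩
      simp only [← map_mul]
      induction f using AlgCrossedProduct.induction with
      | zero => simp
      | add f g hf hg => simpa only [mul_add, map_add] using hf.add hg
      | single s b =>
        simp only [single_mul_single, one_mul, GCStarAlg.action_one_apply]
        exact ((continuous_toMax_single I s).tendsto _).comp (hl.tendsto_mul_right b)
  simpa only [Function.comp_def, map_mul, maxMap_toMax, map_single] using (hc.tendsto y).comp h1

namespace GCStarAlg.IsShortExact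

variable (h : GCStarAlg.IsShortExact i p)
include h

theorem isClosed_range_maxMap : IsClosed (Set.range (maxMap i).hom) :=
  (NonUnitalStarAlgHom.isometry _ h.maxMap_injective).isClosedEmbedding.isClosed_range

theorem mul_mem_range_maxMap (x : (maxSeminorm A).completion) (y : (maxSeminorm I).completion) :
    x * (maxMap i).hom y ∈ Set.range (maxMap i).hom := by
  have hc := CStarAlg.Hom.continuous (maxMap i)
  refine denseRange_toMax.induction_on (p := fun x => x * (maxMap i).hom y ∈ _) x
    (h.isClosed_range_maxMap.preimage (continuous_mul_const _)) fun f => ?_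
  refine denseRange_toMax.induction_on (p := fun y => toMax A f * (maxMap i).hom y ∈ _) y
    (h.isClosed_range_maxMap.preimage (hc.const_mul _)) fun g => ?_
  obtain ⟨k, hk⟩ := (h.map_eq_zero_iff (f * AlgCrossedProduct.map i g)).1 (by
    rw [map_mul, (h.map_eq_zero_iff (AlgCrossedProduct.map i g)).2 ⟨g, rfl⟩, mul_zero])
  exact ⟨toMax I k, by rw [maxMap_toMax, hk, map_mul, maxMap_toMax]⟩

theorem range_maxMap_mul_mem (x : (maxSeminorm A).completion) (y : (maxSeminorm I).completion) :
    (maxMap i).hom y * x ∈ Set.range (maxMap i).hom := by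
  obtain ⟨z, hz⟩ := h.mul_mem_range_maxMap (star x) (star y)
  exact ⟨star z, by rw [map_star, hz, star_mul, star_star, map_star, star_star]⟩

/-- The C*-identity for the quotient norm. -/
theorem norm_mkQ_mul_self_le {N : Submodule ℂ (maxSeminorm A).completion}
    (hN : (N : Set (maxSeminorm A).completion) = Set.range (maxMap i).hom)
    (x : (maxSeminorm A).completion) : ‖N.mkQ x‖ * ‖N.mkQ x‖ ≤ ‖N.mkQ (x * star x)‖ := by
  have hl := CStarAlgebra.increasingApproximateUnit (A := I)
  have hmem : ∀ z, z ∈ N ↔ z ∈ Set.range (maxMap i).hom := fun z => by rw [← hN]; rfl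
  refine le_of_forall_pos_lt_add fun ε hε => ?_
  obtain ⟨n, hn, hlt⟩ := N.exists_norm_add_lt (x * star x) hε
  refine lt_of_le_of_lt ?_ hlt
  obtain ⟨y, rfl⟩ := (hmem n).1 hn
  -- It suffices to show `‖[x]‖² ≤ ‖x x* + n‖ + ‖n - e n‖` eventually, since the last term tends to
  -- zero. The representative `(1 - e) x` of `[x]` does this: its square is `(1 - e) x x* (1 - e)`,
  -- and `x x*` may be replaced by `x x* + n` at the cost of `(1 - e) n`.
  have h1 := (((tendsto_approximateUnit_mul_maxMap i y).const_sub ((maxMap i).hom y)).norm).const_add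
    ‖x * star x + (maxMap i).hom y‖
  rw [sub_self, norm_zero, add_zero] at h1
  refine ge_of_tendsto h1 ?_
  filter_upwards [hl.eventually_norm, hl.eventually_nonneg] with e he he0
  let φ : I →⋆ₙₐ[ℂ] (maxSeminorm A).completion :=
    ((toMax A).comp (singleHom A)).comp i.hom
  have hφ : φ e = toMax A (single 1 (i.hom e)) := rfl
  have hφ' : φ e = (maxMap i).hom (toMax I (single 1 e)) := by
    rw [maxMap_toMax, map_single, hφ]
  rw [← hφ]
  have hpos : 0 ≤ φ e := map_nonneg φ he0
  have hnorm : ‖φ e‖ ≤ 1 := (NonUnitalStarAlgHom.norm_apply_le φ e).trans he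
  have hsa : star (φ e) = φ e := (IsSelfAdjoint.of_nonneg hpos).star_eq
  have h2 : ‖N.mkQ x‖ ≤ ‖x - φ e * x‖ := by
    rw [sub_eq_add_neg]
    refine N.norm_mkQ_le (N.neg_mem ?_)
    rw [hmem, hφ']
    exact h.range_maxMap_mul_mem _ _
  set y' := x * star x
  set n' := (maxMap i).hom y
  have h4 : ∀ w, ‖w - w * φ e‖ ≤ ‖w‖ := fun w => by
    have := norm_sub_mul_le_of_nonneg hpos hnorm (star w)
    rwa [← norm_star, star_sub, star_mul, star_star, hsa, norm_star] at this
  calc ‖N.mkQ x‖ * ‖N.mkQ x‖ ≤ ‖x - φ e * x‖ * ‖x - φ e * x‖ :=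
        mul_self_le_mul_self (norm_nonneg _) h2
    _ = ‖(x - φ e * x) * star (x - φ e * x)‖ := (CStarRing.norm_self_mul_star).symm
    _ = ‖(y' - φ e * y') - (y' - φ e * y') * φ e‖ := by
      congr 1
      rw [star_sub, star_mul, hsa]
      simp only [y', mul_sub, sub_mul, mul_assoc]
    _ ≤ ‖y' - φ e * y'‖ := h4 _
    _ = ‖((y' + n') - φ e * (y' + n')) - (n' - φ e * n')‖ := by
      congr 1
      rw [mul_add]; abel
    _ ≤ ‖(y' + n') - φ e * (y' + n')‖ + ‖n' - φ e * n'‖ := norm_sub_le _ _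
    _ ≤ ‖y' + n'‖ + ‖n' - φ e * n'‖ := by
      gcongr
      exact norm_sub_mul_le_of_nonneg hpos hnorm _

/-- As `N` is a two-sided ideal, `(x + n)(y + m)` represents `x y`; near-optimal `n` and `m` give
the bound. -/
theorem norm_mkQ_mul_le {N : Submodule ℂ (maxSeminorm A).completion}
    (hN : (N : Set (maxSeminorm A).completion) = Set.range (maxMap i).hom)
    (x y : (maxSeminorm A).completion) : ‖N.mkQ (x * y)‖ ≤ ‖N.mkQ x‖ * ‖N.mkQ y‖ := by
  have hmem : ∀ z, z ∈ N ↔ z ∈ Set.range (maxMap i).hom := fun z => by rw [← hN]; rfl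
  have key : ∀ ε > 0, ‖N.mkQ (x * y)‖ ≤ (‖N.mkQ x‖ + ε) * (‖N.mkQ y‖ + ε) := fun ε hε => by
    obtain ⟨n, hn, hxn⟩ := N.exists_norm_add_lt x hε
    obtain ⟨m, hm, hym⟩ := N.exists_norm_add_lt y hε
    have h1 : x * m + n * (y + m) ∈ N := by
      obtain ⟨a, rfl⟩ := (hmem n).1 hn
      obtain ⟨b, rfl⟩ := (hmem m).1 hm
      exact N.add_mem ((hmem _).2 (h.mul_mem_range_maxMap _ _))
        ((hmem _).2 (h.range_maxMap_mul_mem _ _))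
    calc ‖N.mkQ (x * y)‖ ≤ ‖x * y + (x * m + n * (y + m))‖ := N.norm_mkQ_le h1
      _ = ‖(x + n) * (y + m)‖ := by congr 1; rw [add_mul, mul_add x]; abel
      _ ≤ ‖x + n‖ * ‖y + m‖ := norm_mul_le _ _
      _ ≤ _ := by gcongr
  have hlim : Tendsto (fun ε : ℝ => (‖N.mkQ x‖ + ε) * (‖N.mkQ y‖ + ε)) (𝓝[>] 0)
      (𝓝 ((‖N.mkQ x‖ + 0) * (‖N.mkQ y‖ + 0))) :=
    (Continuous.tendsto (by fun_prop) 0).mono_left nhdsWithin_le_nhds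
  simpa using ge_of_tendsto hlim (eventually_mem_nhdsWithin.mono key)

/-- The norm modulo `N`, transported to the algebraic crossed product of `Q` along a linear section,
is a C*-seminorm there and so is dominated by the maximal one. -/
theorem norm_mkQ_toMax_le {N : Submodule ℂ (maxSeminorm A).completion}
    (hN : (N : Set (maxSeminorm A).completion) = Set.range (maxMap i).hom)
    (f : AlgCrossedProduct A) :
    ‖N.mkQ (toMax A f)‖ ≤ (maxSeminorm Q).toSeminorm (AlgCrossedProduct.map p f) := by
  have hmem : ∀ z, z ∈ N ↔ z ∈ Set.range (maxMap i).hom := fun z => by rw [← hN]; rfl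
  -- The class modulo `N` depends only on the image in the crossed product of `Q`. This is why a
  -- section `σ` that respects neither products nor adjoints can be used.
  have heq : ∀ f g, AlgCrossedProduct.map p f = AlgCrossedProduct.map p g →
      N.mkQ (toMax A f) = N.mkQ (toMax A g) := fun f g hfg => by
    refine (Submodule.Quotient.eq N).2 ((hmem _).2 ?_)
    obtain ⟨k, hk⟩ := (h.map_eq_zero_iff (f - g)).1 (by rw [map_sub, hfg, sub_self])
    exact ⟨toMax I k, by rw [maxMap_toMax, hk, map_sub]⟩
  obtain ⟨σ, hσ⟩ := h.exists_linear_rightInverse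
  have hσ' : ∀ g, AlgCrossedProduct.map p (mapLin σ g) = g := fun g => by
    ext s; rw [map_apply, mapLin_apply, hσ]
  let q : CStarSeminorm (AlgCrossedProduct Q) := CStarSeminorm.ofLe
    ((quotientSeminorm A N).comp (mapLin σ))
    (fun x y => by
      simp only [Seminorm.comp_apply, quotientSeminorm_apply]
      rw [heq (mapLin σ (x * y)) (mapLin σ x * mapLin σ y) (by rw [hσ', map_mul, hσ', hσ']),
        map_mul]
      exact h.norm_mkQ_mul_le hN _ _)
    (fun x => by
      simp only [Seminorm.comp_apply, quotientSeminorm_apply]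
      rw [heq (mapLin σ (x * star x)) (mapLin σ x * star (mapLin σ x))
        (by rw [hσ', map_mul, map_star, hσ']), map_mul, map_star]
      exact h.norm_mkQ_mul_self_le hN _)
  rw [heq f (mapLin σ (AlgCrossedProduct.map p f)) (hσ' _).symm]
  exact q.le_maxSeminorm (AlgCrossedProduct.map p f)

/-- The maximal crossed product is exact. -/
theorem isShortExact_maxMap : CStarAlg.IsShortExact (maxMap i) (maxMap p) := by
  let N : Submodule ℂ (maxSeminorm A).completion :=
    LinearMap.range ((maxMap i).hom : (maxSeminorm I).completion →ₗ[ℂ] _)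
  have hN : (N : Set (maxSeminorm A).completion) = Set.range (maxMap i).hom := rfl
  have hc := CStarAlg.Hom.continuous (maxMap p)
  have key : ∀ x, ‖N.mkQ x‖ ≤ ‖(maxMap p).hom x‖ := fun x => by
    have hq : Continuous fun x => ‖N.mkQ x‖ :=
      continuous_norm.comp (continuous_quotient_mk' (s := N.quotientRel))
    refine denseRange_toMax.induction_on (p := fun x => ‖N.mkQ x‖ ≤ ‖(maxMap p).hom x‖) x
      (isClosed_le hq hc.norm) fun f => ?_
    rw [maxMap_toMax, norm_toMax]
    exact h.norm_mkQ_toMax_le hN f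
  have hzero : ∀ n ∈ N, (maxMap p).hom n = 0 := by
    rintro _ ⟨y, rfl⟩
    change (maxMap p).hom ((maxMap i).hom y) = 0
    refine denseRange_toMax.induction_on
      (p := fun y => (maxMap p).hom ((maxMap i).hom y) = 0) y
      (isClosed_eq (hc.comp (CStarAlg.Hom.continuous _)) continuous_const) fun f => ?_
    rw [maxMap_toMax, maxMap_toMax, (h.map_eq_zero_iff _).2 ⟨f, rfl⟩, map_zero]
  refine ⟨h.maxMap_injective, fun x => ⟨fun hx => ?_, ?_⟩, ?_⟩
  · have h1 : ‖N.mkQ x‖ = 0 := le_antisymm ((key x).trans (by rw [hx, norm_zero])) (norm_nonneg _)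
    have h2 := QuotientAddGroup.norm_mk_eq_zero_iff_mem_closure (S := N.toAddSubgroup).1 h1
    exact h.isClosed_range_maxMap.closure_subset h2
  · rintro ⟨y, rfl⟩
    exact hzero _ ⟨y, rfl⟩
  · let T : NormedAddGroupHom (maxSeminorm A).completion (maxSeminorm Q).completion :=
      AddMonoidHom.mkNormedAddGroupHom ((maxMap p).hom : _ →+ _) 1 fun x => by
        rw [one_mul]
        exact NonUnitalStarAlgHom.norm_apply_le (maxMap p).hom x
    -- Taking `ε = ‖p x‖` in the quotient norm gives a preimage of norm below `2‖p x‖`. Preimages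
    -- controlled by a uniform constant persist on the closure of the range by completeness, and the
    -- range is dense.
    have h1 : T.SurjectiveOnWith T.range 2 := by
      rintro _ ⟨x, rfl⟩
      change ∃ g, (maxMap p).hom g = (maxMap p).hom x ∧
        ‖g‖ ≤ 2 * ‖(maxMap p).hom x‖
      rcases (norm_nonneg ((maxMap p).hom x)).eq_or_lt with h0 | h0
      · exact ⟨0, by rw [norm_eq_zero.1 h0.symm, map_zero], by simp⟩
      · obtain ⟨n, hn, hlt⟩ := N.exists_norm_add_lt x h0
        exact ⟨x + n, by rw [map_add, hzero n hn, add_zero], by linarith [key x]⟩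
    have h2 := controlled_closure_of_complete two_pos one_pos h1
    intro y
    obtain ⟨x, hx, -⟩ := h2 y (by
      refine closure_mono ?_ (denseRange_toMax y)
      rintro _ ⟨f, rfl⟩
      obtain ⟨σ, hσ⟩ := h.exists_linear_rightInverse
      refine ⟨toMax A (mapLin σ f), ?_⟩
      change (maxMap p).hom (toMax A (mapLin σ f)) = _
      rw [maxMap_toMax]
      congr 1
      ext s
      rw [map_apply, mapLin_apply, hσ])
    exact ⟨x, hx⟩

end GCStarAlg.IsShortExact

end

/-! ### A criterion for complete positivity -/

noncomputable section

section CompletelyPositive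

theorem CStarAlgebra.exists_eq_star_mul_self {A : Type*} [NonUnitalCStarAlgebra A] [PartialOrder A]
    [StarOrderedRing A] {a : A} (ha : 0 ≤ a) : ∃ b, a = star b * b :=
  CStarAlgebra.nonneg_iff_eq_star_mul_self.1 ha

variable {A B : Type*} [NonUnitalCStarAlgebra A] [NonUnitalCStarAlgebra B]
  [PartialOrder A] [PartialOrder B] [StarOrderedRing A] [StarOrderedRing B]

/-- The matrix is `R* R`, where `R` has `x` as its first row and zeros below. Size zero is separate
because there is no first row. -/
theorem CStarMatrix.gram_nonneg {n : ℕ} (x : Fin n → A) :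
    0 ≤ CStarMatrix.ofMatrix (fun i j => star (x i) * x j) := by
  cases n with
  | zero => exact (CStarMatrix.ext fun i => i.elim0 : (0 : CStarMatrix (Fin 0) (Fin 0) A) = _).le
  | succ n =>
    let R : CStarMatrix (Fin (n + 1)) (Fin (n + 1)) A :=
      CStarMatrix.ofMatrix fun l j => if l = 0 then x j else 0
    have hR : ∀ l j, R l j = if l = 0 then x j else 0 := fun _ _ => rfl
    have h : CStarMatrix.ofMatrix (fun i j => star (x i) * x j) = star R * R := by
      ext i j
      rw [CStarMatrix.mul_apply, Finset.sum_eq_single 0]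
      · rw [CStarMatrix.star_apply, hR, hR, if_pos rfl, if_pos rfl]; rfl
      · intro l _ hl
        rw [hR, if_neg hl, mul_zero]
      · simp
    rw [h]
    exact star_mul_self_nonneg R

/-- A linear map is completely positive if it is positive on the matrices `(xᵢ* xⱼ)`. -/
def CompletelyPositiveMap.ofGram (φ : A →ₗ[ℂ] B) (h : ∀ (n : ℕ) (x : Fin n → A),
    0 ≤ CStarMatrix.ofMatrix (fun i j => φ (star (x i) * x j))) : CompletelyPositiveMap A B where
  toLinearMap := φ
  map_cstarMatrix_nonneg' k M hM := by
    obtain ⟨N, rfl⟩ := CStarAlgebra.exists_eq_star_mul_self hM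
    -- A positive matrix `N* N` is the sum of the Gram matrices of the rows of `N`.
    have h1 : (star N * N).map φ =
        ∑ l, CStarMatrix.ofMatrix (fun i j => φ (star (N l i) * N l j)) := by
      ext i j
      have h2 : ∀ s : Finset (Fin k),
          (∑ l ∈ s, CStarMatrix.ofMatrix (fun i j => φ (star (N l i) * N l j))) i j =
          ∑ l ∈ s, φ (star (N l i) * N l j) := fun s => by
        induction s using Finset.cons_induction with
        | empty => simp
        | cons a s ha hs => rw [Finset.sum_cons, Finset.sum_cons, ← hs]; rfl
      rw [h2, CStarMatrix.map_apply, CStarMatrix.mul_apply, map_sum]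
      rfl
    rw [h1]
    exact Finset.sum_nonneg fun l _ => h k (N l)

end CompletelyPositive

theorem CStarAlg.eq_of_forall_mul_eq {D : CStarAlg.{u}} {x y : D} (h : ∀ z, x * z = y * z) :
    x = y := by
  rw [← sub_eq_zero, ← CStarRing.mul_star_self_eq_zero_iff, sub_mul, h, sub_self]

/-! ### Unitary multipliers and the linking algebra -/

/-- A homomorphism from `G` to the unitary multipliers of the C*-algebra `D`, given by its left
action on `D`. -/
structure UnitaryMultiplierRep (G : Type u) [Group G] (D : CStarAlg.{u}) where
  left : G → D →ₗ[ℂ] D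
  left_one : ∀ x, left 1 x = x
  left_mul : ∀ s t x, left (s * t) x = left s (left t x)
  left_mul_apply : ∀ s x y, left s (x * y) = left s x * y
  star_left_mul_left : ∀ s x y, star (left s x) * left s y = star x * y

namespace UnitaryMultiplierRep

variable {G : Type u} [Group G] {D : CStarAlg.{u}} (U : UnitaryMultiplierRep G D)

/-- Right multiplication by a unitary multiplier. -/
def right (s : G) : D →ₗ[ℂ] D where
  toFun x := star (U.left s⁻¹ (star x))
  map_add' x y := by simp
  map_smul' c x := by simp

theorem right_apply (s : G) (x : D) : U.right s x = star (U.left s⁻¹ (star x)) := rfl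

theorem right_one (x : D) : U.right 1 x = x := by
  rw [right_apply, inv_one, left_one, star_star]

theorem right_mul (s t : G) (x : D) : U.right (s * t) x = U.right t (U.right s x) := by
  simp only [right_apply, mul_inv_rev, left_mul, star_star]

theorem right_mul_apply (s : G) (x y : D) : U.right s (x * y) = x * U.right s y := by
  simp only [right_apply, star_mul, left_mul_apply, star_star]

/-- The identity `(x u_s) y = x (u_s y)`, which makes left and right multiplication a multiplier. It
is unitarity applied at `s⁻¹` to `x*` and `u_s y`. -/
theorem right_mul_eq (s : G) (x y : D) : U.right s x * y = x * U.left s y := by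
  have h := U.star_left_mul_left s⁻¹ (star x) (U.left s y)
  rwa [← left_mul, inv_mul_cancel, left_one, star_star] at h

theorem star_left (s : G) (x : D) : star (U.left s x) = U.right s⁻¹ (star x) := by
  rw [right_apply, inv_inv, star_star]

theorem star_right (s : G) (x : D) : star (U.right s x) = U.left s⁻¹ (star x) := by
  rw [right_apply, star_star]

theorem left_right_comm (s t : G) (x : D) : U.left s (U.right t x) = U.right t (U.left s x) :=
  CStarAlg.eq_of_forall_mul_eq fun y => by
    rw [← left_mul_apply, right_mul_eq, left_mul_apply, right_mul_eq]

theorem norm_left (s : G) (x : D) : ‖U.left s x‖ = ‖x‖ := by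
  rw [← mul_self_inj_of_nonneg (norm_nonneg _) (norm_nonneg _), ← CStarRing.norm_star_mul_self,
    star_left_mul_left, CStarRing.norm_star_mul_self]

theorem norm_right (s : G) (x : D) : ‖U.right s x‖ = ‖x‖ := by
  rw [right_apply, norm_star, norm_left, norm_star]

theorem continuous_right (s : G) : Continuous (U.right s) :=
  (AddMonoidHomClass.isometry_of_norm (U.right s) (U.norm_right s)).continuous

/-- Left multiplication by the `k`-th entry of the unitary multiplier `diag(u_s, 1)`. -/
def diagLeft (k : Fin 2) (s : G) : D →ₗ[ℂ] D := if k = 0 then U.left s else LinearMap.id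

/-- Right multiplication by the adjoint of the `k`-th entry of `diag(u_s, 1)`. -/
def diagRight (k : Fin 2) (s : G) : D →ₗ[ℂ] D := if k = 0 then U.right s⁻¹ else LinearMap.id

theorem diagLeft_one (k : Fin 2) (x : D) : U.diagLeft k 1 x = x := by
  rw [diagLeft]; split_ifs <;> simp [left_one]

theorem diagRight_one (k : Fin 2) (x : D) : U.diagRight k 1 x = x := by
  rw [diagRight]; split_ifs <;> simp [right_one]

theorem diagLeft_mul (k : Fin 2) (s t : G) (x : D) :
    U.diagLeft k (s * t) x = U.diagLeft k s (U.diagLeft k t x) := by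
  simp only [diagLeft]; split_ifs <;> simp [left_mul]

theorem diagRight_mul (k : Fin 2) (s t : G) (x : D) :
    U.diagRight k (s * t) x = U.diagRight k s (U.diagRight k t x) := by
  simp only [diagRight]; split_ifs <;> simp [right_mul]

theorem diagLeft_mul_apply (k : Fin 2) (s : G) (x y : D) :
    U.diagLeft k s (x * y) = U.diagLeft k s x * y := by
  simp only [diagLeft]; split_ifs <;> simp [left_mul_apply]

theorem diagRight_mul_apply (k : Fin 2) (s : G) (x y : D) :
    U.diagRight k s (x * y) = x * U.diagRight k s y := by
  simp only [diagRight]; split_ifs <;> simp [right_mul_apply]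

/-- The inner factors `u_s* u_s` cancel; this is what makes conjugation by `diag(u_s, 1)`
multiplicative on matrices. -/
theorem diagRight_mul_diagLeft (k : Fin 2) (s : G) (x y : D) :
    U.diagRight k s x * U.diagLeft k s y = x * y := by
  simp only [diagRight, diagLeft]
  split_ifs
  · rw [right_mul_eq, ← left_mul, inv_mul_cancel, left_one]
  · rfl

theorem star_diagLeft (k : Fin 2) (s : G) (x : D) :
    star (U.diagLeft k s x) = U.diagRight k s (star x) := by
  simp only [diagRight, diagLeft]; split_ifs <;> simp [star_left]

theorem star_diagRight (k : Fin 2) (s : G) (x : D) :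
    star (U.diagRight k s x) = U.diagLeft k s (star x) := by
  simp only [diagRight, diagLeft]; split_ifs <;> simp [star_right]

theorem diagLeft_diagRight_comm (k l : Fin 2) (s t : G) (x : D) :
    U.diagLeft k s (U.diagRight l t x) = U.diagRight l t (U.diagLeft k s x) := by
  simp only [diagRight, diagLeft]; split_ifs <;> simp [left_right_comm]

/-- Conjugation with the unitary multiplier `diag(u_s, 1)` of `M₂(D)`. -/
def conjHom (s : G) :
    CStarMatrix (Fin 2) (Fin 2) D →⋆ₙₐ[ℂ] CStarMatrix (Fin 2) (Fin 2) D where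
  toFun x := CStarMatrix.ofMatrix fun k l => U.diagLeft k s (U.diagRight l s (x k l))
  map_smul' c x := by
    ext k l
    change U.diagLeft k s (U.diagRight l s (c • x k l)) = _
    rw [map_smul, map_smul]; rfl
  map_zero' := by
    ext k l
    change U.diagLeft k s (U.diagRight l s 0) = _
    rw [map_zero, map_zero]; rfl
  map_add' x y := by
    ext k l
    change U.diagLeft k s (U.diagRight l s (x k l + y k l)) = _
    rw [map_add, map_add]; rfl
  map_mul' x y := by
    ext k l
    rw [CStarMatrix.mul_apply]
    change U.diagLeft k s (U.diagRight l s ((x * y) k l)) =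
      ∑ j, U.diagLeft k s (U.diagRight j s (x k j)) * U.diagLeft j s (U.diagRight l s (y j l))
    rw [CStarMatrix.mul_apply, map_sum, map_sum]
    refine Finset.sum_congr rfl fun j _ => ?_
    rw [← diagLeft_mul_apply, diagRight_mul_diagLeft, diagRight_mul_apply]
  map_star' x := by
    ext k l
    change U.diagLeft k s (U.diagRight l s (star (x l k))) =
      star (U.diagLeft l s (U.diagRight k s (x l k)))
    rw [star_diagLeft, star_diagRight, diagLeft_diagRight_comm]

theorem conjHom_apply (s : G) (x : CStarMatrix (Fin 2) (Fin 2) D) (k l : Fin 2) :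
    U.conjHom s x k l = U.diagLeft k s (U.diagRight l s (x k l)) := rfl

theorem conjHom_mul (s t : G) : U.conjHom (s * t) = (U.conjHom s).comp (U.conjHom t) := by
  ext x k l
  rw [NonUnitalStarAlgHom.comp_apply]
  simp only [conjHom_apply]
  rw [diagLeft_mul, diagRight_mul, diagLeft_diagRight_comm _ k l t s]

theorem conjHom_one : U.conjHom 1 = NonUnitalStarAlgHom.id ℂ _ := by
  ext x k l
  rw [conjHom_apply, diagLeft_one, diagRight_one]; rfl

/-- The C*-algebra `M₂(D)` with the inner action given by `diag(u, 1)`. -/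
def linkingAlg : GCStarAlg G where
  toCStarAlg := ⟨CStarMatrix (Fin 2) (Fin 2) D⟩
  action :=
    { toFun := fun s => StarAlgEquiv.ofNonUnitalStarAlgHom (U.conjHom s) (U.conjHom s⁻¹)
        (by rw [← conjHom_mul, inv_mul_cancel, conjHom_one])
        (by rw [← conjHom_mul, mul_inv_cancel, conjHom_one])
      map_one' := StarAlgEquiv.ext fun x => DFunLike.congr_fun U.conjHom_one x
      map_mul' := fun s t => StarAlgEquiv.ext fun x => DFunLike.congr_fun (U.conjHom_mul s t) x }

/-- The `(k, l)`-entry of an element of the linking algebra. -/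
def entry (k l : Fin 2) : U.linkingAlg →ₗ[ℂ] D where
  toFun x := (x : CStarMatrix (Fin 2) (Fin 2) D) k l
  map_add' _ _ := rfl
  map_smul' _ _ := rfl

/-- The matrix with the single entry `d` at `(k, l)`. -/
def unit (k l : Fin 2) : D →ₗ[ℂ] U.linkingAlg where
  toFun d := (CStarMatrix.ofMatrix fun i j => if i = k ∧ j = l then d else 0 :
    CStarMatrix (Fin 2) (Fin 2) D)
  map_add' x y := CStarMatrix.ext fun i j => by
    change (if _ then _ else _) = (if _ then _ else _) + (if _ then _ else (0 : D))
    split_ifs <;> simp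
  map_smul' c x := CStarMatrix.ext fun i j => by
    change (if _ then _ else _) = c • (if _ then _ else (0 : D))
    split_ifs <;> simp

theorem linkingAlg_ext {x y : U.linkingAlg} (h : ∀ k l, U.entry k l x = U.entry k l y) : x = y :=
  CStarMatrix.ext h

theorem entry_unit (k l i j : Fin 2) (d : D) :
    U.entry i j (U.unit k l d) = if i = k ∧ j = l then d else 0 := rfl

theorem entry_mul (k l : Fin 2) (x y : U.linkingAlg) :
    U.entry k l (x * y) = ∑ j, U.entry k j x * U.entry j l y :=
  CStarMatrix.mul_apply

theorem entry_star (k l : Fin 2) (x : U.linkingAlg) :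
    U.entry k l (star x) = star (U.entry l k x) := rfl

theorem entry_action (k l : Fin 2) (s : G) (x : U.linkingAlg) :
    U.entry k l (U.linkingAlg.action s x) = U.diagLeft k s (U.diagRight l s (U.entry k l x)) := rfl

theorem unit_mul_unit (k l m : Fin 2) (c d : D) :
    U.unit k l c * U.unit l m d = U.unit k m (c * d) := by
  refine U.linkingAlg_ext fun i j => ?_
  simp only [entry_mul, entry_unit]
  rw [Finset.sum_eq_single l (fun n _ hn => by simp [hn]) (by simp)]
  by_cases hi : i = k <;> by_cases hj : j = m <;> simp [hi, hj]

theorem star_unit (k l : Fin 2) (d : D) : star (U.unit k l d) = U.unit l k (star d) := by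
  refine U.linkingAlg_ext fun i j => ?_
  rw [entry_star, entry_unit, entry_unit]
  by_cases hi : i = l <;> by_cases hj : j = k <;> simp [hi, hj]

theorem action_unit (k l : Fin 2) (s : G) (d : D) :
    U.linkingAlg.action s (U.unit k l d) = U.unit k l (U.diagLeft k s (U.diagRight l s d)) := by
  refine U.linkingAlg_ext fun i j => ?_
  rw [entry_action, entry_unit, entry_unit]
  split_ifs with h
  · rw [h.1, h.2]
  · rw [map_zero, map_zero]

/-- The inclusion of `D` as a diagonal corner of the linking algebra. -/
def corner (k : Fin 2) : D →⋆ₙₐ[ℂ] U.linkingAlg where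
  toFun := U.unit k k
  map_smul' := map_smul _
  map_zero' := map_zero _
  map_add' := map_add _
  map_mul' x y := (U.unit_mul_unit k k k x y).symm
  map_star' x := (U.star_unit k k x).symm

/-- An off-diagonal inclusion is not multiplicative, but `x* x` of its image lies in a diagonal
corner, where the inclusion is a *-homomorphism. -/
theorem norm_unit_le (k l : Fin 2) (d : D) : ‖U.unit k l d‖ ≤ ‖d‖ := by
  refine abs_le_of_sq_le_sq' ?_ (norm_nonneg _) |>.2
  rw [sq, sq, ← CStarRing.norm_star_mul_self, ← CStarRing.norm_star_mul_self, star_unit,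
    unit_mul_unit]
  exact NonUnitalStarAlgHom.norm_apply_le (U.corner l) _

end UnitaryMultiplierRep

end

/-! ### The unitary multipliers of the maximal crossed product -/

noncomputable section

open Filter Topology AlgCrossedProduct

variable {G : Type u} [Group G] {A B : GCStarAlg G}

namespace AlgCrossedProduct

/-- Left multiplication by the unitary multiplier `u_s` of the algebraic crossed product. -/
def translate (s : G) : AlgCrossedProduct A →ₗ[ℂ] AlgCrossedProduct A :=
  liftLin fun t => single (s * t) ∘ₗ (A.action s : A →ₗ[ℂ] A)

@[simp] theorem translate_single (s t : G) (a : A) :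
    translate s (single t a) = single (s * t) (A.action s a) := liftLin_single _ _ _

theorem translate_one (f : AlgCrossedProduct A) : translate 1 f = f := by
  induction f using AlgCrossedProduct.induction with
  | zero => rw [map_zero]
  | add f g hf hg => rw [map_add, hf, hg]
  | single s a => rw [translate_single, one_mul, GCStarAlg.action_one_apply]

theorem translate_mul (s t : G) (f : AlgCrossedProduct A) :
    translate (s * t) f = translate s (translate t f) := by
  induction f using AlgCrossedProduct.induction with
  | zero => simp only [map_zero]
  | add f g hf hg => simp only [map_add, hf, hg]
  | single r a => simp only [translate_single, mul_assoc, GCStarAlg.action_mul_apply]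

theorem translate_mul_apply (s : G) (f g : AlgCrossedProduct A) :
    translate s (f * g) = translate s f * g := by
  induction f using AlgCrossedProduct.induction with
  | zero => simp only [map_zero, zero_mul]
  | add f f' hf hf' => simp only [map_add, add_mul, hf, hf']
  | single t a =>
    induction g using AlgCrossedProduct.induction with
    | zero => simp only [map_zero, mul_zero]
    | add f f' hf hf' => simp only [map_add, mul_add, hf, hf']
    | single r b =>
      simp only [translate_single, single_mul_single]
      rw [map_mul (A.action s), GCStarAlg.action_mul_apply, mul_assoc]

theorem star_translate_mul_translate (s : G) (f g : AlgCrossedProduct A) :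
    star (translate s f) * translate s g = star f * g := by
  induction f using AlgCrossedProduct.induction with
  | zero => simp only [map_zero, star_zero, zero_mul]
  | add f f' hf hf' => simp only [map_add, star_add, add_mul, hf, hf']
  | single t a =>
    induction g using AlgCrossedProduct.induction with
    | zero => simp only [map_zero, mul_zero]
    | add f f' hf hf' => simp only [map_add, mul_add, hf, hf']
    | single r b =>
      simp only [translate_single, star_single, single_mul_single, ← map_mul, ← map_star]
      rw [← GCStarAlg.action_mul_apply, mul_inv_rev, inv_mul_cancel_right, mul_assoc,
        inv_mul_cancel_left]

/-- Unitarity at the algebraic level determines the norm through the C*-identity, so `u_s` extends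
to the completion. -/
theorem norm_toMax_translate (s : G) (f : AlgCrossedProduct A) :
    ‖toMax A (translate s f)‖ = ‖toMax A f‖ := by
  rw [← mul_self_inj_of_nonneg (norm_nonneg _) (norm_nonneg _), ← CStarRing.norm_star_mul_self,
    ← map_star, ← map_mul, star_translate_mul_translate, map_mul, map_star,
    CStarRing.norm_star_mul_self]

end AlgCrossedProduct

/-- Left multiplication by the unitary multiplier `u_s` of the maximal crossed product. -/
def maxTranslate (A : GCStarAlg G) (s : G) :
    (maxSeminorm A).completion →L[ℂ] (maxSeminorm A).completion :=
  CStarAlg.extend ((toMax A : AlgCrossedProduct A →ₗ[ℂ] (maxSeminorm A).completion) ∘ₗ translate s)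
    (toMax A : AlgCrossedProduct A →ₗ[ℂ] (maxSeminorm A).completion)

theorem maxTranslate_toMax (s : G) (f : AlgCrossedProduct A) :
    maxTranslate A s (toMax A f) = toMax A (translate s f) :=
  CStarAlg.extend_apply denseRange_toMax (fun f => (norm_toMax_translate s f).le) f

/-- The canonical unitary multipliers of the maximal crossed product. -/
def maxUnitary (A : GCStarAlg G) : UnitaryMultiplierRep G (maxSeminorm A).completion where
  left s := maxTranslate A s
  left_one x := by
    refine denseRange_toMax.induction_on (p := fun x => maxTranslate A 1 x = x) x
      (isClosed_eq (by fun_prop) (by fun_prop)) fun f => ?_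
    rw [maxTranslate_toMax, translate_one]
  left_mul s t x := by
    refine denseRange_toMax.induction_on
      (p := fun x => maxTranslate A (s * t) x = maxTranslate A s (maxTranslate A t x)) x
      (isClosed_eq (by fun_prop) (by fun_prop)) fun f => ?_
    simp only [maxTranslate_toMax, translate_mul]
  left_mul_apply s x y := by
    refine denseRange_toMax.induction_on₂
      (p := fun x y => maxTranslate A s (x * y) = maxTranslate A s x * y)
      (isClosed_eq (by fun_prop) (by fun_prop)) (fun f g => ?_) x y
    simp only [maxTranslate_toMax, ← map_mul, translate_mul_apply]
  star_left_mul_left s x y := by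
    refine denseRange_toMax.induction_on₂
      (p := fun x y => star (maxTranslate A s x) * maxTranslate A s y = star x * y)
      (isClosed_eq (by fun_prop) (by fun_prop)) (fun f g => ?_) x y
    simp only [maxTranslate_toMax, ← map_mul, ← map_star, star_translate_mul_translate]

theorem maxUnitary_left (s : G) (f : AlgCrossedProduct A) :
    (maxUnitary A).left s (toMax A f) = toMax A (translate s f) := maxTranslate_toMax s f

theorem maxUnitary_right_single (s t : G) (a : A) :
    (maxUnitary A).right s (toMax A (single t a)) = toMax A (single (t * s) a) := by
  rw [UnitaryMultiplierRep.right_apply, ← map_star (toMax A), maxUnitary_left, ← map_star (toMax A), star_single,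
    translate_single, star_single]
  rw [mul_inv_rev, inv_inv, inv_inv, ← GCStarAlg.action_mul_apply, ← map_star (A.action _),
    star_star, ← GCStarAlg.action_mul_apply, ← mul_inv_rev, mul_inv_cancel,
    GCStarAlg.action_one_apply]

/-- Covariance `u_s (a δ_t) u_s* = α_s(a) δ_{s t s⁻¹}`. At `t = 1` it makes the inclusion of `A`
equivariant for the inner action. -/
theorem maxUnitary_conj_single (s t : G) (a : A) :
    (maxUnitary A).left s ((maxUnitary A).right s⁻¹ (toMax A (single t a))) =
      toMax A (single (s * t * s⁻¹) (A.action s a)) := by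
  rw [maxUnitary_right_single, maxUnitary_left, translate_single, mul_assoc]

/-! ### The conditional expectation is completely positive and equivariant -/

/-- Conjugation permutes the points of `G` and fixes `1`, so evaluation at `1` sees only `α_s`. -/
theorem condExp_conj (s : G) (x : (maxSeminorm A).completion) :
    condExp A ((maxUnitary A).left s ((maxUnitary A).right s⁻¹ x)) = A.action s (condExp A x) := by
  classical
  have hr : Continuous ((maxUnitary A).right s⁻¹) := by
    change Continuous fun x => star (maxTranslate A (s⁻¹)⁻¹ (star x))
    fun_prop
  have hl : Continuous ((maxUnitary A).left s) := (maxTranslate A s).continuous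
  have ha : Continuous (A.action s) :=
    NonUnitalStarAlgHom.instContinuousLinearMapClassComplex.map_continuous (A.action s)
  refine denseRange_toMax.induction_on (p := fun x => condExp A ((maxUnitary A).left s
    ((maxUnitary A).right s⁻¹ x)) = A.action s (condExp A x)) x
    (isClosed_eq ((condExp A).continuous.comp (hl.comp hr))
      (ha.comp (condExp A).continuous)) fun f => ?_
  induction f using AlgCrossedProduct.induction with
  | zero => simp only [map_zero]
  | add f g hf hg => simp only [map_add, hf, hg]
  | single t a =>
    rw [maxUnitary_conj_single, condExp_toMax, condExp_toMax, single_apply, single_apply]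
    have h : s * t * s⁻¹ = 1 ↔ t = 1 := by rw [mul_inv_eq_one, mul_eq_left]
    simp only [h]
    split_ifs <;> simp

/-- For finitely supported functions, evaluating `fᵢ* fⱼ` at `1` gives `∑ₛ fᵢ*(s) (fⱼ*(s))*`, so the
matrix is a sum of Gram matrices over `A`. Positivity is a closed condition, and such families are
dense. -/
theorem condExp_gram_nonneg {n : ℕ} (x : Fin n → (maxSeminorm A).completion) :
    0 ≤ CStarMatrix.ofMatrix (fun i j => condExp A (star (x i) * x j)) := by
  classical
  have hd := DenseRange.piMap fun _ : Fin n => denseRange_toMax (A := A)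
  have hc : Continuous fun x : Fin n → (maxSeminorm A).completion =>
      CStarMatrix.ofMatrix (fun i j => condExp A (star (x i) * x j)) := by
    change Continuous fun x : Fin n → (maxSeminorm A).completion =>
      (fun i j => condExp A (star (x i) * x j) : Fin n → Fin n → A)
    fun_prop
  refine hd.induction_on (p := fun x => 0 ≤ CStarMatrix.ofMatrix
    (fun i j => condExp A (star (x i) * x j))) x
    (CStarAlgebra.isClosed_nonneg.preimage hc) fun f => ?_
  -- One finite set containing the supports of all `fᵢ*`, so that every entry is a sum over the same
  -- index set.
  let T : Finset G := Finset.univ.biUnion fun i => (star (f i)).hasFiniteSupport.toFinset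
  have hT : ∀ i, Function.support (star (f i) : AlgCrossedProduct A) ⊆ T := fun i s hs => by
    simp only [T, Finset.coe_biUnion, Set.mem_iUnion]
    exact ⟨i, by simp, by simpa using hs⟩
  have h1 : CStarMatrix.ofMatrix (fun i j => condExp A
      (star (Pi.map (fun _ => toMax A) f i) * Pi.map (fun _ => toMax A) f j)) =
      ∑ s ∈ T, CStarMatrix.ofMatrix (fun i j =>
        star (star (star (f i) s)) * star (star (f j) s)) := by
    ext i j
    have h2 : ∀ S : Finset G, (∑ s ∈ S, CStarMatrix.ofMatrix (fun i j =>
        star (star (star (f i) s)) * star (star (f j) s))) i j =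
        ∑ s ∈ S, star (f i) s * star (star (f j) s) := fun S => by
      induction S using Finset.cons_induction with
      | empty => simp
      | cons a s ha hs => rw [Finset.sum_cons, Finset.sum_cons, ← hs, ← star_star (star (f i) a)]; rfl
    rw [h2, ← mul_star_apply_one _ _ (hT i), star_star, ← condExp_toMax, map_mul, map_star]
    rfl
  rw [h1]
  exact Finset.sum_nonneg fun s _ => CStarMatrix.gram_nonneg fun i => star (star (f i) s)

/-! ### The corners of the linking algebra of the maximal crossed product -/

/-- The linking algebra of the maximal crossed product with its inner and its trivial action. -/
abbrev maxLinking (A : GCStarAlg G) : GCStarAlg G := (maxUnitary A).linkingAlg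

/-- The maximal crossed product with the trivial action. -/
abbrev maxTrivial (A : GCStarAlg G) : GCStarAlg G :=
  (GCStarAlg.trivialAction G).obj (maxSeminorm A).completion

/-- The inclusion of `A` into the upper left corner. -/
def cornerInner (A : GCStarAlg G) : A ⟶ maxLinking A where
  hom := ((maxUnitary A).corner 0).comp ((toMax A).comp (singleHom A))
  equivariant s a := by
    change (maxUnitary A).unit 0 0 (toMax A (single 1 (A.action s a))) =
      (maxLinking A).action s ((maxUnitary A).unit 0 0 (toMax A (single 1 a)))
    rw [UnitaryMultiplierRep.action_unit]
    change _ = (maxUnitary A).unit 0 0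
      ((maxUnitary A).left s ((maxUnitary A).right s⁻¹ (toMax A (single 1 a))))
    rw [maxUnitary_conj_single, mul_one, mul_inv_cancel]

/-- The inclusion of the maximal crossed product into the lower right corner. -/
def cornerTrivial (A : GCStarAlg G) : maxTrivial A ⟶ maxLinking A where
  hom := (maxUnitary A).corner 1
  equivariant s a := ((maxUnitary A).action_unit 1 1 s a).symm

theorem cornerInner_apply (a : A) :
    (cornerInner A).hom a = (maxUnitary A).unit 0 0 (toMax A (single 1 a)) := rfl

/-- The completely positive retraction of `cornerInner`. -/
def retractInner (A : GCStarAlg G) :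
    CompletelyPositiveMap (maxLinking A).toCStarAlg A.toCStarAlg :=
  CompletelyPositiveMap.ofGram
    ((condExp A : (maxSeminorm A).completion →ₗ[ℂ] A) ∘ₗ (maxUnitary A).entry 0 0) fun n x => by
      -- The `(0, 0)` entry of `xᵢ* xⱼ` is a sum over the two entries of the first columns, each
      -- contributing a Gram matrix.
      have h : CStarMatrix.ofMatrix (fun i j => ((condExp A : (maxSeminorm A).completion →ₗ[ℂ] A) ∘ₗ
          (maxUnitary A).entry 0 0) (star (x i) * x j)) =
          CStarMatrix.ofMatrix (fun i j => condExp A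
            (star ((maxUnitary A).entry 0 0 (x i)) * (maxUnitary A).entry 0 0 (x j))) +
          CStarMatrix.ofMatrix (fun i j => condExp A
            (star ((maxUnitary A).entry 1 0 (x i)) * (maxUnitary A).entry 1 0 (x j))) := by
        ext i j
        change condExp A ((maxUnitary A).entry 0 0 (star (x i) * x j)) = condExp A _ + condExp A _
        rw [UnitaryMultiplierRep.entry_mul, Fin.sum_univ_two, map_add]
        rfl
      rw [h]
      exact add_nonneg (condExp_gram_nonneg _) (condExp_gram_nonneg _)

/-- The completely positive retraction of `cornerTrivial`. -/
def retractTrivial (A : GCStarAlg G) :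
    CompletelyPositiveMap (maxLinking A).toCStarAlg (maxTrivial A).toCStarAlg :=
  CompletelyPositiveMap.ofGram ((maxUnitary A).entry 1 1) fun n x => by
    have h : CStarMatrix.ofMatrix (fun i j => (maxUnitary A).entry 1 1 (star (x i) * x j)) =
        CStarMatrix.ofMatrix (fun i j =>
          star ((maxUnitary A).entry 0 1 (x i)) * (maxUnitary A).entry 0 1 (x j)) +
        CStarMatrix.ofMatrix (fun i j =>
          star ((maxUnitary A).entry 1 1 (x i)) * (maxUnitary A).entry 1 1 (x j)) := by
      ext i j
      change (maxUnitary A).entry 1 1 (star (x i) * x j) = _ + _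
      rw [UnitaryMultiplierRep.entry_mul, Fin.sum_univ_two]
      rfl
    exact h ▸ add_nonneg (CStarMatrix.gram_nonneg _) (CStarMatrix.gram_nonneg _)

theorem retractInner_apply (x : maxLinking A) :
    retractInner A x = condExp A ((maxUnitary A).entry 0 0 x) := rfl

theorem retractInner_cornerInner (a : A) : retractInner A ((cornerInner A).hom a) = a := by
  classical
  rw [retractInner_apply, cornerInner_apply, UnitaryMultiplierRep.entry_unit, if_pos ⟨rfl, rfl⟩,
    condExp_toMax, single_apply, if_pos rfl]

theorem retractTrivial_cornerTrivial (x : maxTrivial A) :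
    retractTrivial A ((cornerTrivial A).hom x) = x :=
  ((maxUnitary A).entry_unit 1 1 1 1 x).trans (if_pos ⟨rfl, rfl⟩)

theorem retractInner_action (s : G) (x : maxLinking A) :
    retractInner A ((maxLinking A).action s x) = A.action s (retractInner A x) :=
  condExp_conj s _

theorem retractTrivial_action (s : G) (x : maxLinking A) :
    retractTrivial A ((maxLinking A).action s x) =
      (maxTrivial A).action s (retractTrivial A x) := rfl

end

/-! ### Crossed product functors -/

noncomputable section

open Filter Topology AlgCrossedProduct

variable {G : Type u} [Group G] {A B I Q : GCStarAlg G}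

theorem tendsto_mul_mul_approximateUnit {D : Type*} [NonUnitalCStarAlgebra D] [PartialOrder D]
    [StarOrderedRing D] (y : D) :
    Tendsto (fun e => e * y * e) (CStarAlgebra.approximateUnit D) (𝓝 y) := by
  have hl := CStarAlgebra.increasingApproximateUnit (A := D)
  rw [tendsto_iff_norm_sub_tendsto_zero]
  have h1 := tendsto_iff_norm_sub_tendsto_zero.1 (hl.tendsto_mul_left y)
  have h2 := tendsto_iff_norm_sub_tendsto_zero.1 (hl.tendsto_mul_right y)
  have h3 := h1.add h2
  rw [add_zero] at h3
  refine squeeze_zero' (.of_forall fun _ => norm_nonneg _) ?_ h3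
  filter_upwards [hl.eventually_norm] with e he
  calc ‖e * y * e - y‖ = ‖e * (y * e - y) + (e * y - y)‖ := by
        rw [mul_sub, ← mul_assoc, sub_add_sub_cancel]
    _ ≤ ‖e * (y * e - y)‖ + ‖e * y - y‖ := norm_add_le _ _
    _ ≤ ‖y * e - y‖ + ‖e * y - y‖ := by
      gcongr
      exact (norm_mul_le _ _).trans (mul_le_of_le_one_left (norm_nonneg _) he)

namespace CrossedProductFunctor

variable (F : CrossedProductFunctor G)

theorem map_ofAlg (φ : A ⟶ B) (f : AlgCrossedProduct A) :
    (F.functor.map φ).hom (F.ofAlg A f) = F.ofAlg B (AlgCrossedProduct.map φ f) := by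
  have h := congrArg (fun ψ => ψ.hom (toMax A f)) (F.q.naturality φ)
  refine Eq.trans h.symm ?_
  exact congrArg (F.q.app B).hom (maxMap_toMax φ f)

theorem denseRange_ofAlg (A : GCStarAlg G) : DenseRange (F.ofAlg A) :=
  (F.q_surjective A).denseRange.comp denseRange_toMax (CStarAlg.Hom.continuous (F.q.app A))

theorem norm_ofAlg_single_le (s : G) (a : A) : ‖F.ofAlg A (single s a)‖ ≤ ‖a‖ :=
  (NonUnitalStarAlgHom.norm_apply_le (F.q.app A).hom _).trans
    ((norm_toMax _).le.trans (maxSeminorm_single_le s a))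

theorem continuous_ofAlg_single (A : GCStarAlg G) (s : G) :
    Continuous fun a : A => F.ofAlg A (single s a) :=
  (CStarAlg.Hom.continuous (F.q.app A)).comp (continuous_toMax_single A s)

/-- Both quotient maps `q` are surjective and natural, so surjectivity descends from `⋊_max`. -/
theorem map_surjective {φ : A ⟶ B} (h : Function.Surjective (maxMap φ).hom) :
    Function.Surjective (F.functor.map φ).hom := fun y => by
  obtain ⟨z, rfl⟩ := F.q_surjective B y
  obtain ⟨x, rfl⟩ := h z
  exact ⟨(F.q.app A).hom x, (congrArg (fun ψ => ψ.hom x) (F.q.naturality φ)).symm⟩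

variable {F}

/-- A correspondence functor maps a morphism with an equivariant completely positive retraction to
an isometric *-homomorphism. -/
theorem IsCorrespondence.norm_map (hF : F.IsCorrespondence) (j : A ⟶ B)
    (φ : CompletelyPositiveMap B.toCStarAlg A.toCStarAlg)
    (hφ : ∀ s b, φ (B.action s b) = A.action s (φ b)) (hj : ∀ a, φ (j.hom a) = a)
    (f : AlgCrossedProduct A) : ‖F.ofAlg B (AlgCrossedProduct.map j f)‖ = ‖F.ofAlg A f‖ := by
  obtain ⟨Φ, hΦ⟩ := hF B A φ hφ
  have hc : Continuous Φ := map_continuous Φ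
  -- `φ ⋊_μ G` is a left inverse of `j ⋊_μ G`, which is therefore an injective, hence isometric,
  -- *-homomorphism.
  have key : ∀ x, Φ ((F.functor.map j).hom x) = x := fun x => by
    refine (F.denseRange_ofAlg A).induction_on (p := fun x => Φ ((F.functor.map j).hom x) = x) x
      (isClosed_eq (hc.comp (CStarAlg.Hom.continuous _)) continuous_id) fun f => ?_
    rw [map_ofAlg, hΦ]
    congr 1
    ext s
    rw [mapLin_apply, map_apply]
    exact hj _
  rw [← map_ofAlg]
  exact NonUnitalStarAlgHom.norm_map _ (Function.LeftInverse.injective key) _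

variable (F)

/-- Used in both directions to compare the two corners: off-diagonal contractions stand in for the
partial isometry exchanging them, which exists only as a multiplier. -/
theorem norm_le_of_tendsto_conj {ι : Type*} {l : Filter ι} [l.NeBot] {v w : ι → A}
    (hv : ∀ᶠ e in l, ‖v e‖ ≤ 1) (hw : ∀ᶠ e in l, ‖w e‖ ≤ 1) {x y : AlgCrossedProduct A}
    (h : Tendsto (fun e => F.ofAlg A (single 1 (v e) * x * single 1 (w e))) l (𝓝 (F.ofAlg A y))) :
    ‖F.ofAlg A y‖ ≤ ‖F.ofAlg A x‖ := by
  refine le_of_tendsto h.norm ?_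
  filter_upwards [hv, hw] with e h1 h2
  rw [map_mul, map_mul]
  have h3 := (F.norm_ofAlg_single_le 1 (v e)).trans h1
  have h4 := (F.norm_ofAlg_single_le 1 (w e)).trans h2
  calc _ ≤ ‖F.ofAlg A (single 1 (v e))‖ * ‖F.ofAlg A x‖ * ‖F.ofAlg A (single 1 (w e))‖ :=
        norm_mul₃_le
    _ ≤ 1 * ‖F.ofAlg A x‖ * 1 := by gcongr
    _ = _ := by ring

end CrossedProductFunctor

/-! ### The dual coaction on the algebraic crossed product. -/

/-- The element `x ⊗ δ_s` of the algebraic crossed product of `A ⋊_max G` by the trivial action. -/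
def trivialSingle (A : GCStarAlg G) (s : G) :
    (maxSeminorm A).completion →ₗ[ℂ] AlgCrossedProduct (maxTrivial A) :=
  single (A := maxTrivial A) s

theorem trivialSingle_mul_trivialSingle (s t : G) (x y : (maxSeminorm A).completion) :
    trivialSingle A s x * trivialSingle A t y = trivialSingle A (s * t) (x * y) :=
  single_mul_single (A := maxTrivial A) s t x y

theorem star_trivialSingle (s : G) (x : (maxSeminorm A).completion) :
    star (trivialSingle A s x) = trivialSingle A s⁻¹ (star x) :=
  star_single (A := maxTrivial A) s x

theorem map_trivialSingle_maxMap (φ : A ⟶ B) (s : G) (x : (maxSeminorm A).completion) :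
    AlgCrossedProduct.map ((GCStarAlg.trivialAction G).map (maxMap φ)) (trivialSingle A s x) =
      trivialSingle B s ((maxMap φ).hom x) :=
  map_single ((GCStarAlg.trivialAction G).map (maxMap φ)) s x

theorem map_trivialSingle_cornerTrivial (s : G) (x : (maxSeminorm A).completion) :
    AlgCrossedProduct.map (cornerTrivial A) (trivialSingle A s x) =
      single (A := maxLinking A) s ((maxUnitary A).unit 1 1 x) :=
  map_single (cornerTrivial A) s (show maxTrivial A from x)

/-- The *-homomorphism `a δ_s ↦ (a δ_s) ⊗ δ_s` from `A ⋊_alg G` to the algebraic crossed product of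
`A ⋊_max G` by the trivial action. -/
def dualCoaction (A : GCStarAlg G) : AlgCrossedProduct A →⋆ₙₐ[ℂ] AlgCrossedProduct (maxTrivial A) :=
  AlgCrossedProduct.lift
    (fun s => trivialSingle A s ∘ₗ
      (toMax A : AlgCrossedProduct A →ₗ[ℂ] (maxSeminorm A).completion) ∘ₗ single s)
    (fun s t a b => by
      change trivialSingle A (s * t) (toMax A (single (s * t) (a * A.action s b))) =
        trivialSingle A s (toMax A (single s a)) * trivialSingle A t (toMax A (single t b))
      rw [trivialSingle_mul_trivialSingle, ← map_mul, single_mul_single])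
    (fun s a => by
      change trivialSingle A s⁻¹ (toMax A (single s⁻¹ (A.action s⁻¹ (star a)))) =
        star (trivialSingle A s (toMax A (single s a)))
      rw [star_trivialSingle, ← map_star (toMax A), star_single])

theorem dualCoaction_single (s : G) (a : A) :
    dualCoaction A (single s a) = trivialSingle A s (toMax A (single s a)) :=
  lift_single _ _ _ s a

theorem map_dualCoaction (φ : A ⟶ B) (f : AlgCrossedProduct A) :
    AlgCrossedProduct.map ((GCStarAlg.trivialAction G).map (maxMap φ)) (dualCoaction A f) =
      dualCoaction B (AlgCrossedProduct.map φ f) := by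
  induction f using AlgCrossedProduct.induction with
  | zero => simp only [map_zero]
  | add f g hf hg => simp only [map_add, hf, hg]
  | single s a =>
    rw [dualCoaction_single, map_trivialSingle_maxMap, maxMap_toMax, map_single,
      dualCoaction_single]

/-! ### The dual coaction is isometric on `A ⋊_μ G`. -/

namespace CrossedProductFunctor

variable (F : CrossedProductFunctor G)

/-- Moving the right-hand factor across `δ_s` applies the action, which multiplies its `(0, 1)`
entry by `u_s`. The product has entry `e a u_s e = e (a δ_s) e` at `(1, 1)`, which tends to `a δ_s`:
the coaction appears because the action is inner on one corner and trivial on the other. -/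
theorem tendsto_conj_cornerInner (f : AlgCrossedProduct A) :
    Tendsto (fun e => F.ofAlg (maxLinking A) (single 1 ((maxUnitary A).unit 1 0 e) *
        AlgCrossedProduct.map (cornerInner A) f * single 1 ((maxUnitary A).unit 0 1 e)))
      (CStarAlgebra.approximateUnit (maxSeminorm A).completion)
      (𝓝 (F.ofAlg (maxLinking A) (AlgCrossedProduct.map (cornerTrivial A) (dualCoaction A f)))) := by
  induction f using AlgCrossedProduct.induction with
  | zero => simp
  | add f g hf hg => simpa only [mul_add, add_mul, map_add] using hf.add hg
  | single s a =>
    have hU : Continuous ((maxUnitary A).unit 1 1) :=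
      NonUnitalStarAlgHom.instContinuousLinearMapClassComplex.map_continuous ((maxUnitary A).corner 1)
    have h1 := ((F.continuous_ofAlg_single (maxLinking A) s).comp hU).tendsto
      (toMax A (single s a)) |>.comp
        (tendsto_mul_mul_approximateUnit (toMax A (single s a) : (maxSeminorm A).completion))
    rw [dualCoaction_single, map_trivialSingle_cornerTrivial, map_single]
    refine h1.congr fun e => ?_
    rw [single_mul_single, single_mul_single, one_mul, mul_one, GCStarAlg.action_one_apply,
      cornerInner_apply, UnitaryMultiplierRep.unit_mul_unit, UnitaryMultiplierRep.action_unit,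
      UnitaryMultiplierRep.unit_mul_unit]
    change F.ofAlg _ (single s ((maxUnitary A).unit 1 1 _)) =
      F.ofAlg _ (single s ((maxUnitary A).unit 1 1
        (e * toMax A (single 1 a) * (maxUnitary A).left s e)))
    rw [mul_assoc e (toMax A (single 1 a)), ← UnitaryMultiplierRep.right_mul_eq,
      maxUnitary_right_single, one_mul, ← mul_assoc]

/-- In the reverse direction the `(1, 0)` entry picks up `u_s*` on the right, so `a δ_s` is turned
back into `a δ_1`. -/
theorem tendsto_conj_cornerTrivial (f : AlgCrossedProduct A) :
    Tendsto (fun e => F.ofAlg (maxLinking A) (single 1 ((maxUnitary A).unit 0 1 e) *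
        AlgCrossedProduct.map (cornerTrivial A) (dualCoaction A f) *
          single 1 ((maxUnitary A).unit 1 0 e)))
      (CStarAlgebra.approximateUnit (maxSeminorm A).completion)
      (𝓝 (F.ofAlg (maxLinking A) (AlgCrossedProduct.map (cornerInner A) f))) := by
  induction f using AlgCrossedProduct.induction with
  | zero => simp
  | add f g hf hg => simpa only [mul_add, add_mul, map_add] using hf.add hg
  | single s a =>
    have hU : Continuous ((maxUnitary A).unit 0 0) :=
      NonUnitalStarAlgHom.instContinuousLinearMapClassComplex.map_continuous ((maxUnitary A).corner 0)
    have hr : Continuous ((maxUnitary A).right s⁻¹) := (maxUnitary A).continuous_right s⁻¹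
    have h1 := (((F.continuous_ofAlg_single (maxLinking A) s).comp hU).comp hr).tendsto
      (toMax A (single s a)) |>.comp
        (tendsto_mul_mul_approximateUnit (toMax A (single s a) : (maxSeminorm A).completion))
    simp only [Function.comp_def] at h1
    rw [maxUnitary_right_single, mul_inv_cancel] at h1
    rw [dualCoaction_single, map_trivialSingle_cornerTrivial, map_single]
    refine h1.congr fun e => ?_
    rw [single_mul_single, single_mul_single, one_mul, mul_one, GCStarAlg.action_one_apply,
      UnitaryMultiplierRep.unit_mul_unit, UnitaryMultiplierRep.action_unit,
      UnitaryMultiplierRep.unit_mul_unit]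
    change F.ofAlg _ (single s ((maxUnitary A).unit 0 0 _)) =
      F.ofAlg _ (single s ((maxUnitary A).unit 0 0
        (e * toMax A (single s a) * (maxUnitary A).right s⁻¹ e)))
    rw [UnitaryMultiplierRep.right_mul_apply]

variable {F}

/-- Both norms can be computed in the crossed product of the linking algebra, where each element is
a limit of contractive two-sided multiples of the other. -/
theorem IsCorrespondence.norm_dualCoaction (hF : F.IsCorrespondence) (f : AlgCrossedProduct A) :
    ‖F.ofAlg (maxTrivial A) (dualCoaction A f)‖ = ‖F.ofAlg A f‖ := by
  have hl := CStarAlgebra.increasingApproximateUnit (A := (maxSeminorm A).completion)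
  have hu : ∀ k l, ∀ᶠ e in CStarAlgebra.approximateUnit (maxSeminorm A).completion,
      ‖(maxUnitary A).unit k l e‖ ≤ 1 := fun k l =>
    hl.eventually_norm.mono fun e he => ((maxUnitary A).norm_unit_le k l e).trans he
  rw [← hF.norm_map (cornerTrivial A) (retractTrivial A) retractTrivial_action
      retractTrivial_cornerTrivial,
    ← hF.norm_map (cornerInner A) (retractInner A) retractInner_action retractInner_cornerInner]
  exact le_antisymm
    (F.norm_le_of_tendsto_conj (hu 1 0) (hu 0 1) (F.tendsto_conj_cornerInner f))
    (F.norm_le_of_tendsto_conj (hu 0 1) (hu 1 0) (F.tendsto_conj_cornerTrivial f))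

variable (F)

/-- The extension of `dualCoaction` to `A ⋊_μ G`. -/
def dualCoactionMap (A : GCStarAlg G) :
    F.functor.obj A →L[ℂ] F.functor.obj (maxTrivial A) :=
  CStarAlg.extend ((F.ofAlg (maxTrivial A)).comp (dualCoaction A) :
    AlgCrossedProduct A →ₗ[ℂ] F.functor.obj (maxTrivial A))
    (F.ofAlg A : AlgCrossedProduct A →ₗ[ℂ] F.functor.obj A)

variable {F}

namespace IsCorrespondence

variable (hF : F.IsCorrespondence)
include hF

theorem dualCoactionMap_ofAlg (f : AlgCrossedProduct A) :
    F.dualCoactionMap A (F.ofAlg A f) = F.ofAlg (maxTrivial A) (dualCoaction A f) :=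
  CStarAlg.extend_apply (F.denseRange_ofAlg A) (fun f => (hF.norm_dualCoaction f).le) f

theorem norm_dualCoactionMap (x : F.functor.obj A) : ‖F.dualCoactionMap A x‖ = ‖x‖ := by
  refine (F.denseRange_ofAlg A).induction_on (p := fun x => ‖F.dualCoactionMap A x‖ = ‖x‖) x
    (isClosed_eq (by fun_prop) (by fun_prop)) fun f => ?_
  rw [hF.dualCoactionMap_ofAlg, hF.norm_dualCoaction]

theorem dualCoactionMap_map (φ : A ⟶ B) (x : F.functor.obj A) :
    (F.tensorFunctor.map (maxMap φ)).hom (F.dualCoactionMap A x) =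
      F.dualCoactionMap B ((F.functor.map φ).hom x) := by
  refine (F.denseRange_ofAlg A).induction_on (p := fun x =>
    (F.tensorFunctor.map (maxMap φ)).hom (F.dualCoactionMap A x) =
      F.dualCoactionMap B ((F.functor.map φ).hom x)) x
    (isClosed_eq ((CStarAlg.Hom.continuous _).comp (F.dualCoactionMap A).continuous)
      ((F.dualCoactionMap B).continuous.comp (CStarAlg.Hom.continuous _))) fun f => ?_
  rw [map_ofAlg, hF.dualCoactionMap_ofAlg, hF.dualCoactionMap_ofAlg, ← map_dualCoaction]
  exact F.map_ofAlg _ _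

/-- Elements of `A` sit at the identity of `G`, so the coaction sends them to `a ⊗ 1`. This lets an
approximate unit of `I` pass through the coaction. -/
theorem dualCoactionMap_mul (a : A) (x : F.functor.obj A) :
    F.dualCoactionMap A (F.ofAlg A (single 1 a) * x) =
      F.ofAlg (maxTrivial A) (trivialSingle A 1 (toMax A (single 1 a))) * F.dualCoactionMap A x := by
  refine (F.denseRange_ofAlg A).induction_on (p := fun x =>
    F.dualCoactionMap A (F.ofAlg A (single 1 a) * x) =
      F.ofAlg (maxTrivial A) (trivialSingle A 1 (toMax A (single 1 a))) * F.dualCoactionMap A x) x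
    (isClosed_eq (by fun_prop) (by fun_prop)) fun f => ?_
  rw [← map_mul, hF.dualCoactionMap_ofAlg, hF.dualCoactionMap_ofAlg, map_mul, map_mul,
    dualCoaction_single]

end IsCorrespondence

/-- An approximate unit of `I` still acts as one on the image of `(I ⋊_max G) ⊗_μ C*_μ(G)`, since it
does so on the first tensor factor. -/
theorem tendsto_approximateUnit_mul_map (i : I ⟶ A)
    (y : F.functor.obj (maxTrivial I)) :
    Tendsto (fun e : I => (F.ofAlg (maxTrivial A) (trivialSingle A 1 (toMax A (single 1 (i.hom e)))) *
        (F.functor.map ((GCStarAlg.trivialAction G).map (maxMap i))).hom y : F.functor.obj (maxTrivial A)))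
      (CStarAlgebra.approximateUnit I) (𝓝 ((F.functor.map ((GCStarAlg.trivialAction G).map (maxMap i))).hom y)) := by
  have hl := CStarAlgebra.increasingApproximateUnit (A := I)
  refine tendsto_mul_of_mem_closure (S := Set.range fun f =>
    (F.functor.map ((GCStarAlg.trivialAction G).map (maxMap i))).hom (F.ofAlg (maxTrivial I) f)) ?_ ?_ ?_
  · filter_upwards [hl.eventually_norm] with e he
    refine (F.norm_ofAlg_single_le (A := maxTrivial A) _ _).trans ((norm_toMax _).le.trans
      ((maxSeminorm_single_le _ _).trans ((NonUnitalStarAlgHom.norm_apply_le i.hom e).trans he)))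
  · rintro _ ⟨f, rfl⟩
    have h1 : (F.functor.map ((GCStarAlg.trivialAction G).map (maxMap i))).hom (F.ofAlg (maxTrivial I) f) =
      F.ofAlg (maxTrivial A) (AlgCrossedProduct.map ((GCStarAlg.trivialAction G).map (maxMap i)) f) :=
      F.map_ofAlg _ _
    simp only [h1, ← map_mul]
    clear h1
    induction f using AlgCrossedProduct.induction with
    | zero => simp
    | add f g hf hg => simpa only [mul_add, map_add] using hf.add hg
    | single s b =>
      have h1 : AlgCrossedProduct.map ((GCStarAlg.trivialAction G).map (maxMap i)) (single s b) =
          trivialSingle A s ((maxMap i).hom b) := map_trivialSingle_maxMap i s b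
      simp only [h1, trivialSingle_mul_trivialSingle, one_mul]
      exact ((F.continuous_ofAlg_single (maxTrivial A) s).tendsto _).comp
        (tendsto_approximateUnit_mul_maxMap i b)
  · exact (CStarAlg.Hom.continuous (F.functor.map ((GCStarAlg.trivialAction G).map (maxMap i)))).range_subset_closure_image_dense
      (F.denseRange_ofAlg (maxTrivial I)) ⟨y, rfl⟩ |> fun h => by
        rwa [← Set.range_comp] at h

end CrossedProductFunctor

end

/-! ### Exactness from exactness on trivial actions. -/

noncomputable section

open Filter Topology AlgCrossedProduct

variable {G : Type u} [Group G] {I A Q : GCStarAlg G}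

namespace CrossedProductFunctor

variable {F : CrossedProductFunctor G}

/-- A correspondence crossed product functor is exact if `A ↦ A ⊗_μ C*_μ(G)` is exact. -/
theorem IsCorrespondence.isExact (hF : F.IsCorrespondence)
    (hT : CStarAlg.IsExactFunctor F.tensorFunctor) : F.IsExact := by
  intro I A Q i p h
  have hm : CStarAlg.IsShortExact
      (F.functor.map ((GCStarAlg.trivialAction G).map (maxMap i)))
      (F.functor.map ((GCStarAlg.trivialAction G).map (maxMap p))) :=
    hT (maxMap i) (maxMap p) h.isShortExact_maxMap
  have hinj : Function.Injective (F.functor.map i).hom := by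
    refine (injective_iff_map_eq_zero _).2 fun x hx => ?_
    have h1 := hF.dualCoactionMap_map i x
    rw [hx, map_zero] at h1
    rw [← norm_eq_zero, ← hF.norm_dualCoactionMap,
      (injective_iff_map_eq_zero _).1 hm.injective _ h1, norm_zero]
  have hclosed : IsClosed (Set.range (F.functor.map i).hom) :=
    (NonUnitalStarAlgHom.isometry _ hinj).isClosedEmbedding.isClosed_range
  -- `c x` lies in the image of `I ⋊_μ G`: this holds for `x` in the algebraic crossed product
  -- because `I` is an ideal, and the image is closed.
  have hmul : ∀ (c : I) (x : F.functor.obj A),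
      F.ofAlg A (single 1 (i.hom c)) * x ∈ Set.range (F.functor.map i).hom := fun c x => by
    refine (F.denseRange_ofAlg A).induction_on
      (p := fun x => F.ofAlg A (single 1 (i.hom c)) * x ∈ Set.range (F.functor.map i).hom) x
      (hclosed.preimage (continuous_const_mul _)) fun f => ?_
    obtain ⟨k, hk⟩ := (h.map_eq_zero_iff (single 1 (i.hom c) * f)).1 (by
      rw [map_mul, ← map_single, (h.map_eq_zero_iff _).2 ⟨_, rfl⟩, zero_mul])
    exact ⟨F.ofAlg I k, by rw [map_ofAlg, hk, map_mul]⟩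
  refine ⟨hinj, fun x => ⟨fun hx => ?_, ?_⟩, F.map_surjective h.isShortExact_maxMap.surjective⟩
  -- Naturality puts `δ_A(x)` in the kernel for `Q`, hence in the image for `I`. There `δ_A(e x) =
  -- (e ⊗ 1) δ_A(x) → δ_A(x)`, and an isometry reflects convergence, so `e x → x`.
  · have h1 := hF.dualCoactionMap_map p x
    rw [hx, map_zero] at h1
    obtain ⟨y, hy⟩ := (hm.exact _).1 h1
    have h2 := F.tendsto_approximateUnit_mul_map i y
    rw [hy] at h2
    simp only [← hF.dualCoactionMap_mul] at h2
    have h3 : Isometry (F.dualCoactionMap A) :=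
      AddMonoidHomClass.isometry_of_norm _ hF.norm_dualCoactionMap
    have hl := CStarAlgebra.increasingApproximateUnit (A := I)
    have h4 := h3.isEmbedding.tendsto_nhds_iff.2 h2
    exact hclosed.mem_of_tendsto h4 (.of_forall fun e => hmul e x)
  · rintro ⟨y, rfl⟩
    refine (F.denseRange_ofAlg I).induction_on
      (p := fun y => (F.functor.map p).hom ((F.functor.map i).hom y) = 0) y
      (isClosed_eq ((CStarAlg.Hom.continuous _).comp (CStarAlg.Hom.continuous _))
        continuous_const) fun f => ?_
    rw [map_ofAlg, map_ofAlg, (h.map_eq_zero_iff _).2 ⟨f, rfl⟩, map_zero]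

theorem IsExactForTrivialActions.isExactFunctor (hF : F.IsExactForTrivialActions) :
    CStarAlg.IsExactFunctor F.tensorFunctor := fun i p h =>
  hF ((GCStarAlg.trivialAction G).map i) ((GCStarAlg.trivialAction G).map p)
    (fun _ _ => rfl) (fun _ _ => rfl) (fun _ _ => rfl) h

end CrossedProductFunctor

end

theorem mainTheorem3 {G : Type u} [Group G] (F : CrossedProductFunctor G)
    (hF : F.IsCorrespondence) :
    (F.IsExact ↔ F.IsExactForTrivialActions) ∧
      (F.IsExact ↔ CStarAlg.IsExactFunctor F.tensorFunctor) := by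
  have h1 : F.IsExact → F.IsExactForTrivialActions := fun h _ _ _ i p _ _ _ => h i p
  exact ⟨⟨h1, fun h => hF.isExact h.isExactFunctor⟩,
    fun h => CrossedProductFunctor.IsExactForTrivialActions.isExactFunctor (h1 h), hF.isExact⟩
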